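/- All graphs are finite, undirected and simple; $\delta(G)$ is the minimum degree of $G$. For $k\ge 1$, a graph is $k$-connected if it has more than $k$ vertices and remains connected after the deletion of any set of fewer than $k$ vertices. A $k$-removable $\ell$-matching of a $k$-connected graph $G$ is a matching $M\subseteq E(G)$ with $|M|=\ell$ such that the graph $G-M$ (with the same vertex set and edge set $E(G)\setminus M$) is still $k$-connected. (i) Let $k\in\{1,2\}$. Every $k$-connected graph $G$ with $\delta(G)\ge k+1$ contains a $k$-removable $\lceil(\delta(G)+1)/2\rceil$-matching, unless $\delta(G)=2$ and $G$ is a cycle, or $\delta(G)\ge 4$ is even and $G$ is a complete graph of order $\delta(G)+1$. (ii) Every $3$-connected graph $G$ with $\delta(G)\ge 5$ contains a $3$-removable $\lceil(\delta(G)+1)/2\rceil$-matching, unless $\delta(G)$ is even and $G\cong K_{\delta(G)+1}$. -/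

import Mathlib

namespace SimpleGraph

/-- A finite graph is `k`-connected if it has more than `k` vertices and stays connected after the
deletion of any set of fewer than `k` vertices. -/
def IsVertexConnected {V : Type*} [Fintype V] (G : SimpleGraph V) (k : ℕ) : Prop :=
  k < Fintype.card V ∧
    ∀ S : Finset V, S.card < k → (G.induce {v : V | v ∉ S}).Connected

/-- `G` contains a `k`-removable `ℓ`-matching: a matching `M` of `G` with exactly `ℓ` edges such
that deleting the edges of `M` (and keeping all vertices) leaves a `k`-connected graph. -/
def HasRemovableMatching {V : Type*} [Fintype V] (G : SimpleGraph V) (k ℓ : ℕ) : Prop :=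
  ∃ M : G.Subgraph, M.IsMatching ∧ M.edgeSet.ncard = ℓ ∧
    (G.deleteEdges M.edgeSet).IsVertexConnected k

/-- `G` is a cycle: it is isomorphic to the cycle graph on `n` vertices for some `n ≥ 3`. -/
def IsCycleGraph {V : Type*} (G : SimpleGraph V) : Prop :=
  ∃ n : ℕ, 3 ≤ n ∧ Nonempty (G ≃g cycleGraph n)

end SimpleGraph

/-!
Let `d` be the minimum degree of `G`. For `d ≥ 3` a removable matching `N` with `2|N| ≤ d` is
enlarged by one edge; the bound `⌈(d + 1) / 2⌉` is exactly where this process stops. Write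
`H = G \ N` and let `U` be the set of unmatched vertices. If no edge inside `U` can be added to
`N`, every edge of `H` inside `U` is critical for the `k`-connectivity of `H`. In all cases at hand
`d ≥ 2k - 1`, and then a short version of Mader's theorem
(`IsVertexConnected.exists_card_neighbors_le_one_of_critical`) shows that `U` induces a forest.
Unless `G` is complete of odd order `d + 1`, the set `U` has at least two vertices, so two of them,
`u` and `v`, have at most one neighbour in `U`. As there are at most `d` matched vertices, `u` and
`v` are adjacent to all of them with at most one exception each.

If both are adjacent to both ends of an edge `xy` of `N`, then `xy` is exchanged for `ux` and `yv`.
A small separator of the new graph would be crossed in `H` by just one of `ux`, `yv`, and would cut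
off a part of the forest with fewer than two leaves (`IsSaturated.false_of_isEdgeSeparation`).
Such an edge `xy` fails to exist only if `d = 4` and `N` consists of two edges, with `u` and `v`
missing ends of different edges (`IsMatchingGraph.exists_of_cover`); another exchange then works
(`IsSaturated.isVertexConnected_of_swap_four`).

For `d = 2` and `k = 1`, a connected graph other than a cycle has more edges than vertices, so two
of its edges can be deleted without disconnecting it. If they share a vertex, one of them is
replaced by an edge of a path joining its ends (`hasRemovableMatching_two_of_common`).
-/

namespace SimpleGraph

/-! ### Separations and vertex connectivity -/

section

variable {V : Type*}

/-- `S` separates `A` from `B` in `H`: the three sets partition the vertices, `A` and `B` are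
nonempty, and no edge of `H` joins `A` to `B`. The union of components `A` is recorded instead of
a single component, so that the roles of `A` and `B` are symmetric. -/
structure IsSeparation (H : SimpleGraph V) (S A B : Finset V) : Prop where
  left_nonempty : A.Nonempty
  right_nonempty : B.Nonempty
  cover : ∀ v, v ∈ A ∨ v ∈ B ∨ v ∈ S
  notMem_right : ∀ v ∈ A, v ∉ B
  notMem_of_left : ∀ v ∈ A, v ∉ S
  notMem_of_right : ∀ v ∈ B, v ∉ S
  not_adj : ∀ a ∈ A, ∀ b ∈ B, ¬ H.Adj a b

theorem IsSeparation.symm {H : SimpleGraph V} {S A B : Finset V} (h : H.IsSeparation S A B) :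
    H.IsSeparation S B A where
  left_nonempty := h.right_nonempty
  right_nonempty := h.left_nonempty
  cover v := by have := h.cover v; tauto
  notMem_right v hv hv' := h.notMem_right v hv' hv
  notMem_of_left := h.notMem_of_right
  notMem_of_right := h.notMem_of_left
  not_adj a ha b hb hab := h.not_adj b hb a ha hab.symm

/-- The three sets partition the vertices, and `xy`, with `x ∈ A` and `y ∈ B`, is the only edge
of `H` between `A` and `B`; that is, `S` separates `x` from `y` once `xy` is deleted. -/
structure IsEdgeSeparation (H : SimpleGraph V) (x y : V) (S A B : Finset V) : Prop where
  left_mem : x ∈ A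
  right_mem : y ∈ B
  adj : H.Adj x y
  cover : ∀ v, v ∈ A ∨ v ∈ B ∨ v ∈ S
  notMem_right : ∀ v ∈ A, v ∉ B
  notMem_of_left : ∀ v ∈ A, v ∉ S
  notMem_of_right : ∀ v ∈ B, v ∉ S
  eq_of_adj : ∀ a ∈ A, ∀ b ∈ B, H.Adj a b → a = x ∧ b = y


theorem IsEdgeSeparation.symm {H : SimpleGraph V} {x y : V} {S A B : Finset V}
    (h : H.IsEdgeSeparation x y S A B) : H.IsEdgeSeparation y x S B A where
  left_mem := h.right_mem
  right_mem := h.left_mem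
  adj := h.adj.symm
  cover v := by have := h.cover v; tauto
  notMem_right v hv hv' := h.notMem_right v hv' hv
  notMem_of_left := h.notMem_of_right
  notMem_of_right := h.notMem_of_left
  eq_of_adj a ha b hb hab := (h.eq_of_adj b hb a ha hab.symm).symm

variable [Fintype V]

open Classical in
/-- Vertex connectivity expressed by the absence of small separators. -/
theorem isVertexConnected_iff {H : SimpleGraph V} {k : ℕ} :
    H.IsVertexConnected k ↔ k < Fintype.card V ∧
      ∀ S A B : Finset V, S.card < k → ¬ H.IsSeparation S A B := by
  refine and_congr_right fun hk => ⟨fun h S A B hS hsep => ?_, fun h S hS => ?_⟩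
  · obtain ⟨a, ha⟩ := hsep.left_nonempty
    obtain ⟨b, hb⟩ := hsep.right_nonempty
    obtain ⟨p⟩ := (h S hS).preconnected ⟨a, hsep.notMem_of_left a ha⟩
      ⟨b, hsep.notMem_of_right b hb⟩
    have key : ∀ (x y : {v : V | v ∉ S}), (H.induce {v : V | v ∉ S}).Walk x y →
        x.1 ∈ A → y.1 ∈ A := by
      intro x y p
      induction p with
      | nil => exact id
      | @cons x w _ hadj _ ih =>
        intro hx
        apply ih
        rcases hsep.cover w.1 with hw | hw | hw
        · exact hw
        · exact absurd hadj (hsep.not_adj _ hx _ hw)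
        · exact absurd hw w.2
    exact hsep.notMem_right b (key _ _ p ha) hb
  · have hne : ∃ v, v ∉ S := by
      by_contra! hall
      have : S = Finset.univ := Finset.eq_univ_iff_forall.2 hall
      rw [this, Finset.card_univ] at hS
      omega
    obtain ⟨v₀, hv₀⟩ := hne
    have : Nonempty {v : V | v ∉ S} := ⟨⟨v₀, hv₀⟩⟩
    refine ⟨fun a b => ?_⟩
    by_contra hab
    let A : Finset V := Finset.univ.filter
      fun v => ∃ hv : v ∉ S, (H.induce {v : V | v ∉ S}).Reachable a ⟨v, hv⟩
    refine h S A (Finset.univ \ (A ∪ S)) hS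
      ⟨⟨a.1, ?_⟩, ⟨b.1, ?_⟩, ?_, ?_, ?_, ?_, ?_⟩
    · exact Finset.mem_filter.2 ⟨Finset.mem_univ _, a.2, Reachable.refl _⟩
    · have hb : b.1 ∉ S := b.2
      simp only [Finset.mem_sdiff, Finset.mem_univ, Finset.mem_union, true_and, A,
        Finset.mem_filter, not_or, not_exists]
      exact ⟨fun _ h => hab h, hb⟩
    · intro v
      simp only [Finset.mem_sdiff, Finset.mem_univ, Finset.mem_union, true_and]
      tauto
    · intro v hv
      simp [hv]
    · intro v hv
      exact (Finset.mem_filter.1 hv).2.1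
    · intro v hv
      simp only [Finset.mem_sdiff, Finset.mem_univ, Finset.mem_union, true_and] at hv
      tauto
    · intro x hx y hy hxy
      obtain ⟨hxS, hx⟩ := (Finset.mem_filter.1 hx).2
      simp only [Finset.mem_sdiff, Finset.mem_univ, Finset.mem_union, true_and, not_or] at hy
      refine hy.1 (Finset.mem_filter.2 ⟨Finset.mem_univ _, hy.2, hx.trans ?_⟩)
      exact Adj.reachable (G := H.induce {v : V | v ∉ S}) (u := ⟨x, hxS⟩) (v := ⟨y, hy.2⟩) hxy

open Classical in
/-- In a `k`-connected graph a set `C` that contains the neighbours of `D` outside `D`, and does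
not exhaust the rest of the graph, has at least `k` vertices. -/
theorem IsVertexConnected.le_card_of_boundary {H : SimpleGraph V} {k : ℕ}
    (hH : H.IsVertexConnected k) {C D : Finset V} (hD : D.Nonempty)
    (hDC : ∀ v ∈ D, v ∉ C) (hout : ∃ v, v ∉ D ∧ v ∉ C)
    (hN : ∀ a ∈ D, ∀ b, H.Adj a b → b ∈ D ∨ b ∈ C) : k ≤ C.card := by
  by_contra! hk
  obtain ⟨v, hvD, hvC⟩ := hout
  refine (isVertexConnected_iff.1 hH).2 C D (Finset.univ \ (D ∪ C)) hk
    ⟨hD, ⟨v, by simp [hvD, hvC]⟩, ?_, ?_, hDC, ?_, ?_⟩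
  · intro v; simp only [Finset.mem_sdiff, Finset.mem_univ, Finset.mem_union, true_and]; tauto
  · intro v hv; simp [hv]
  · intro v hv
    simp only [Finset.mem_sdiff, Finset.mem_univ, Finset.mem_union, true_and] at hv; tauto
  · intro a ha b hb hab
    simp only [Finset.mem_sdiff, Finset.mem_univ, Finset.mem_union, true_and] at hb
    exact hb (hN a ha b hab)

open Classical in
/-- If, apart from at most two edges at a single vertex `x` of degree more than `k`, all edges
leaving `D` end in `C`, then `C` has at least `k - 1` vertices: either `C ∪ {x}` bounds `D \ {x}`,
or `D = {x}` and the degree of `x` forces `C` to be large. -/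
theorem IsVertexConnected.pred_le_card_of_boundary {H : SimpleGraph V} {k : ℕ}
    (hH : H.IsVertexConnected k) {C D : Finset V} {x y z : V} (hD : D.Nonempty)
    (hDC : ∀ v ∈ D, v ∉ C) (hout : ∃ v, v ∉ D ∧ v ∉ C ∧ v ≠ x)
    (hdeg : k + 1 ≤ (Finset.univ.filter (H.Adj x)).card)
    (hN : ∀ a ∈ D, ∀ b, H.Adj a b → b ∈ D ∨ b ∈ C ∨ a = x ∧ (b = y ∨ b = z)) :
    k ≤ C.card + 1 := by
  by_cases hx : (D.erase x).Nonempty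
  · refine (hH.le_card_of_boundary (C := insert x C) (D := D.erase x) hx ?_ ?_ ?_).trans
      (Finset.card_insert_le _ _)
    · intro v hv
      simp only [Finset.mem_erase] at hv
      simp [hv.1, hDC v hv.2]
    · obtain ⟨v, h1, h2, h3⟩ := hout
      exact ⟨v, by simp [h1], by simp [h2, h3]⟩
    · intro a ha b hab
      simp only [Finset.mem_erase] at ha
      have := hN a ha.2 b hab
      simp only [Finset.mem_erase, Finset.mem_insert]
      tauto
  · have hDx : D = {x} := by
      rw [Finset.not_nonempty_iff_eq_empty, Finset.erase_eq_empty_iff] at hx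
      exact hx.resolve_left hD.ne_empty
    have hsub : Finset.univ.filter (H.Adj x) ⊆ insert y (insert z C) := by
      intro b hb
      have hb := (Finset.mem_filter.1 hb).2
      have := hN x (by simp [hDx]) b hb
      rw [hDx, Finset.mem_singleton] at this
      have hne := hb.ne'
      simp only [Finset.mem_insert]
      tauto
    have h1 := Finset.card_le_card hsub
    have h2 := Finset.card_insert_le y (insert z C)
    have h3 := Finset.card_insert_le z C
    omega

/-- An edge whose deletion destroys `k`-connectivity has a separation of order less than `k`. -/
theorem IsVertexConnected.exists_isEdgeSeparation {H : SimpleGraph V} {k : ℕ}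
    (hH : H.IsVertexConnected k) {x y : V} (hxy : H.Adj x y)
    (hcrit : ¬ (H \ edge x y).IsVertexConnected k) :
    ∃ S A B : Finset V, S.card < k ∧ H.IsEdgeSeparation x y S A B := by
  rw [isVertexConnected_iff] at hH hcrit
  push Not at hcrit
  obtain ⟨S, A, B, hS, hsep⟩ := hcrit hH.1
  have key : ∃ a ∈ A, ∃ b ∈ B, H.Adj a b := by
    by_contra! hno
    exact hH.2 S A B hS { hsep with not_adj := hno }
  have hedge : ∀ a ∈ A, ∀ b ∈ B, H.Adj a b → a = x ∧ b = y ∨ a = y ∧ b = x := by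
    intro a ha b hb hab
    have := hsep.not_adj a ha b hb
    rw [sdiff_adj, edge_adj] at this
    have := hab.ne
    tauto
  obtain ⟨a, ha, b, hb, hab⟩ := key
  rcases hedge a ha b hb hab with ⟨rfl, rfl⟩ | ⟨rfl, rfl⟩
  · refine ⟨S, A, B, hS, ha, hb, hxy, hsep.cover, hsep.notMem_right, hsep.notMem_of_left,
      hsep.notMem_of_right, fun c hc d hd hcd => ?_⟩
    rcases hedge c hc d hd hcd with h | ⟨rfl, rfl⟩
    · exact h
    · exact absurd hb (hsep.notMem_right _ hc)
  · refine ⟨S, B, A, hS, hb, ha, hxy, hsep.symm.cover, hsep.symm.notMem_right,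
      hsep.notMem_of_right, hsep.notMem_of_left, fun c hc d hd hcd => ?_⟩
    rcases hedge d hd c hc hcd.symm with ⟨rfl, rfl⟩ | h
    · exact absurd ha (hsep.symm.notMem_right _ hc)
    · exact h.symm

end

/-! ### Critical edges among vertices of large degree -/

section

variable {V : Type*}

open Classical in
/-- For partitions `(X, S, _)` and `(Z, T, _)` of the vertices, the part of `S ∪ T` that can have
neighbours in the corner `X ∩ Z`. -/
noncomputable def corner (S T X Z : Finset V) : Finset V := S ∩ Z ∪ S ∩ T ∪ T ∩ X

theorem mem_corner {S T X Z : Finset V} {v : V} :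
    v ∈ corner S T X Z ↔ v ∈ S ∧ v ∈ Z ∨ v ∈ S ∧ v ∈ T ∨ v ∈ T ∧ v ∈ X := by
  simp only [corner, Finset.mem_union, Finset.mem_inter, or_assoc]

open Classical in
/-- Submodularity: opposite corners have boundaries of total size at most `|S| + |T|`. -/
theorem card_corner_add_card_corner_le {S T X Y Z W : Finset V} (hXY : ∀ v ∈ X, v ∉ Y)
    (hZW : ∀ v ∈ Z, v ∉ W) (hXS : ∀ v ∈ X, v ∉ S) (hYS : ∀ v ∈ Y, v ∉ S) :
    (corner S T X Z).card + (corner S T Y W).card ≤ S.card + T.card := by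
  rw [← Finset.card_union_add_card_inter, ← Finset.card_union_add_card_inter S T]
  refine add_le_add (Finset.card_le_card fun v hv => ?_) (Finset.card_le_card fun v hv => ?_)
  · simp only [Finset.mem_union, mem_corner] at hv ⊢
    tauto
  · simp only [Finset.mem_inter, mem_corner] at hv ⊢
    have := hXY v; have := hZW v; have := hXS v; have := hYS v
    tauto

/-- An edge leaving a corner ends in its boundary, or is one of the two separated edges. -/
theorem IsEdgeSeparation.corner_boundary {H : SimpleGraph V} {x y x' y' : V}
    {S A B T A' B' : Finset V} (h : H.IsEdgeSeparation x y S A B)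
    (h' : H.IsEdgeSeparation x' y' T A' B') {a b : V} (ha : a ∈ A) (ha' : a ∈ A')
    (hab : H.Adj a b) :
    (b ∈ A ∧ b ∈ A') ∨ b ∈ corner S T A A' ∨ a = x ∧ b = y ∨ a = x' ∧ b = y' := by
  have h1 := h.cover b
  have h2 := h'.cover b
  have h3 := fun hb => h.eq_of_adj a ha b hb hab
  have h4 := fun hb => h'.eq_of_adj a ha' b hb hab
  rw [mem_corner]
  tauto

theorem IsEdgeSeparation.notMem_corner {H : SimpleGraph V} {x y x' y' : V}
    {S A B T A' B' : Finset V} (h : H.IsEdgeSeparation x y S A B)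
    (h' : H.IsEdgeSeparation x' y' T A' B') {a : V} (ha : a ∈ A) (ha' : a ∈ A') :
    a ∉ corner S T A A' := by
  rw [mem_corner]
  have := h.notMem_of_left a ha
  have := h'.notMem_of_left a ha'
  tauto

theorem IsEdgeSeparation.notMem_corner_of_right {H : SimpleGraph V} {x y : V}
    {S A B T A' : Finset V} (h : H.IsEdgeSeparation x y S A B) {b : V} (hb : b ∈ B) :
    b ∉ corner S T A A' := by
  rw [mem_corner]
  have := h.notMem_of_right b hb
  have := fun hA => h.notMem_right b hA hb
  tauto

open Classical in
/-- If every nonempty subset of `U` induces a graph with a vertex of degree at most one (so that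
`U` induces a forest), then every `W ⊆ U` with two elements induces a graph with two such
vertices: one of them avoids any given `v`. -/
theorem exists_ne_card_neighbors_le_one {H : SimpleGraph V} {U : Finset V}
    (hU : ∀ W ⊆ U, W.Nonempty → ∃ w ∈ W, (W.filter (H.Adj w)).card ≤ 1) :
    ∀ W ⊆ U, 2 ≤ W.card → ∀ v, ∃ w ∈ W, w ≠ v ∧ (W.filter (H.Adj w)).card ≤ 1 := by
  intro W
  induction W using Finset.strongInduction with
  | H W ih =>
    intro hWU hW v
    obtain ⟨w, hw, hw1⟩ := hU W hWU (Finset.card_pos.1 (by omega))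
    by_cases hwv : w = v
    swap
    · exact ⟨w, hw, hwv, hw1⟩
    subst hwv
    -- putting `w` back only affects the degree of its neighbours, of which there is at most one
    have key : ∀ a ∈ W.erase w, ((W.erase w).filter (H.Adj a)).card ≤ 1 → ¬ H.Adj a w →
        (W.filter (H.Adj a)).card ≤ 1 := by
      intro a _ ha1 haw
      refine (Finset.card_le_card fun b hb => ?_).trans ha1
      rw [Finset.mem_filter] at hb
      rw [Finset.mem_filter, Finset.mem_erase]
      exact ⟨⟨fun hbw => haw (hbw ▸ hb.2), hb.1⟩, hb.2⟩
    have hcard := Finset.card_erase_add_one hw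
    by_cases h3 : 2 ≤ (W.erase w).card
    · have hss : W.erase w ⊂ W := Finset.erase_ssubset hw
      have ihw := ih _ hss (hss.subset.trans hWU) h3
      obtain ⟨a, ha, -, ha1⟩ := ihw w
      obtain ⟨b, hb, hba, hb1⟩ := ihw a
      by_cases haw : H.Adj a w
      · refine ⟨b, Finset.mem_of_mem_erase hb, Finset.ne_of_mem_erase hb,
          key b hb hb1 fun hbw => ?_⟩
        have : 2 ≤ (W.filter (H.Adj w)).card := by
          refine Finset.one_lt_card.2 ⟨a, ?_, b, ?_, hba.symm⟩
          · exact Finset.mem_filter.2 ⟨Finset.mem_of_mem_erase ha, haw.symm⟩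
          · exact Finset.mem_filter.2 ⟨Finset.mem_of_mem_erase hb, hbw.symm⟩
        omega
      · exact ⟨a, Finset.mem_of_mem_erase ha, Finset.ne_of_mem_erase ha, key a ha ha1 haw⟩
    · obtain ⟨a, ha⟩ := Finset.card_pos.1 (show 0 < (W.erase w).card by omega)
      refine ⟨a, Finset.mem_of_mem_erase ha, Finset.ne_of_mem_erase ha, ?_⟩
      have hsub : W.filter (H.Adj a) ⊆ W.erase a := fun b hb => by
        rw [Finset.mem_filter] at hb
        exact Finset.mem_erase.2 ⟨hb.2.ne', hb.1⟩
      have h1 := Finset.card_le_card hsub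
      have h2 := Finset.card_erase_add_one (Finset.mem_of_mem_erase ha)
      omega

variable [Fintype V]

open Classical in
/-- A form of Mader's theorem for vertices of degree at least `2 * k - 1` and more than `k`: if
every edge inside `W` is critical for `k`-connectivity, then some vertex of `W` has at most one
neighbour in `W`.

Otherwise take, among all separations of edges `xy` inside `W`, one with `|Y|` minimal, and a
second edge `yz` inside `W` with its separation `(Y', T, Z)`. Comparing opposite corners gives
`X ∩ Z = ∅`, then `X ∩ Y' = ∅` or `Y ∩ Z = ∅`, so that `X ⊆ T` or `Z ⊆ S`. In both cases
`|Y| < k`, too few vertices for the degree of `y`. -/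
theorem IsVertexConnected.exists_card_neighbors_le_one_of_critical {H : SimpleGraph V} {k : ℕ}
    (hH : H.IsVertexConnected k) {W : Finset V} (hW : W.Nonempty)
    (hdeg : ∀ v ∈ W, k + 1 ≤ (Finset.univ.filter (H.Adj v)).card)
    (hdeg' : ∀ v ∈ W, 2 * k ≤ (Finset.univ.filter (H.Adj v)).card + 1)
    (hcrit : ∀ x ∈ W, ∀ y ∈ W, H.Adj x y → ¬ (H \ edge x y).IsVertexConnected k) :
    ∃ w ∈ W, (W.filter (H.Adj w)).card ≤ 1 := by
  by_contra! hnb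
  have hex : ∃ n : ℕ, ∃ x ∈ W, ∃ y ∈ W, ∃ S X Y : Finset V, S.card < k ∧
      H.IsEdgeSeparation x y S X Y ∧ Y.card = n := by
    obtain ⟨x, hx⟩ := hW
    obtain ⟨y, hy, -⟩ := Finset.one_lt_card.1 (hnb x hx)
    obtain ⟨hy, hxy⟩ := Finset.mem_filter.1 hy
    obtain ⟨S, X, Y, hS, h⟩ := hH.exists_isEdgeSeparation hxy (hcrit x hx y hy hxy)
    exact ⟨_, x, hx, y, hy, S, X, Y, hS, h, rfl⟩
  obtain ⟨x, hx, y, hy, S, X, Y, hS, h, hYn⟩ := Nat.find_spec hex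
  have hmin : ∀ {x' y' : V} {S' X' Y' : Finset V}, x' ∈ W → y' ∈ W → S'.card < k →
      H.IsEdgeSeparation x' y' S' X' Y' → Y.card ≤ Y'.card := by
    intro x' y' S' X' Y' hx' hy' hS' h'
    rw [hYn]
    exact Nat.find_min' hex ⟨x', hx', y', hy', S', X', Y', hS', h', rfl⟩
  clear hYn hex
  obtain ⟨z, hz, hyz, hzx⟩ : ∃ z ∈ W, H.Adj y z ∧ z ≠ x := by
    obtain ⟨z, hz, hne⟩ := Finset.exists_mem_ne (hnb y hy) x
    exact ⟨z, (Finset.mem_filter.1 hz).1, (Finset.mem_filter.1 hz).2, hne⟩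
  obtain ⟨T, Y', Z, hT, h'⟩ := hH.exists_isEdgeSeparation hyz (hcrit y hy z hz hyz)
  have hYX := hmin hy hx hS h.symm
  have hYZ := hmin hy hz hT h'
  have hxZ : x ∉ Z := fun hxZ => hzx.symm (h'.eq_of_adj y h'.left_mem x hxZ h.adj.symm).2
  have hzX : z ∉ X := fun hzX => hzx (h.eq_of_adj z hzX y h.right_mem hyz.symm).1
  have hyX : y ∉ X := h.symm.notMem_right y h.right_mem
  have hyZ : y ∉ Z := h'.notMem_right y h'.left_mem
  have hxY : x ∉ Y := h.notMem_right x h.left_mem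
  have hzY' : z ∉ Y' := h'.symm.notMem_right z h'.right_mem
  have hXZ : ∀ v ∈ X, v ∉ Z := by
    by_contra! hne
    obtain ⟨v, hvX, hvZ⟩ := hne
    have h1 : k ≤ (corner S T X Z).card := by
      refine hH.le_card_of_boundary (D := X ∩ Z)
        ⟨v, Finset.mem_inter.2 ⟨hvX, hvZ⟩⟩ ?_ ⟨y, ?_, ?_⟩ ?_
      · intro w hw
        rw [Finset.mem_inter] at hw
        exact h.notMem_corner h'.symm hw.1 hw.2
      · simp [hyX]
      · exact h.notMem_corner_of_right h.right_mem
      · intro a ha b hab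
        rw [Finset.mem_inter] at ha ⊢
        rcases h.corner_boundary h'.symm ha.1 ha.2 hab with hb | hb | ⟨rfl, -⟩ | ⟨rfl, -⟩
        · exact Or.inl hb
        · exact Or.inr hb
        · exact absurd ha.2 hxZ
        · exact absurd ha.1 hzX
    have h2 := card_corner_add_card_corner_le (T := T) h.notMem_right
      h'.symm.notMem_right h.notMem_of_left h.notMem_of_right
    have h3 : k ≤ (corner S T Y Y').card + 1 := by
      refine hH.pred_le_card_of_boundary (D := Y ∩ Y') (x := y) (y := x) (z := z)
        ⟨y, Finset.mem_inter.2 ⟨h.right_mem, h'.left_mem⟩⟩ ?_ ⟨x, ?_, ?_, h.adj.ne⟩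
        (hdeg y hy) ?_
      · intro w hw
        rw [Finset.mem_inter] at hw
        exact h.symm.notMem_corner h' hw.1 hw.2
      · simp [hxY]
      · exact h.symm.notMem_corner_of_right h.left_mem
      · intro a ha b hab
        rw [Finset.mem_inter] at ha ⊢
        rcases h.symm.corner_boundary h' ha.1 ha.2 hab with hb | hb | hb | hb
        · exact Or.inl hb
        · exact Or.inr (Or.inl hb)
        · exact Or.inr (Or.inr ⟨hb.1, Or.inl hb.2⟩)
        · exact Or.inr (Or.inr ⟨hb.1, Or.inr hb.2⟩)
    omega
  have hcases : (∀ v ∈ X, v ∉ Y') ∨ (∀ v ∈ Y, v ∉ Z) := by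
    by_contra! hne
    obtain ⟨⟨v, hvX, hvY'⟩, ⟨w, hwY, hwZ⟩⟩ := hne
    have h1 : k ≤ (corner S T X Y').card + 1 := by
      refine hH.pred_le_card_of_boundary (D := X ∩ Y') (x := x) (y := y) (z := y)
        ⟨v, Finset.mem_inter.2 ⟨hvX, hvY'⟩⟩ ?_ ⟨y, ?_, ?_, h.adj.ne'⟩ (hdeg x hx) ?_
      · intro w hw
        rw [Finset.mem_inter] at hw
        exact h.notMem_corner h' hw.1 hw.2
      · simp [hyX]
      · exact h.notMem_corner_of_right h.right_mem
      · intro a ha b hab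
        rw [Finset.mem_inter] at ha ⊢
        rcases h.corner_boundary h' ha.1 ha.2 hab with hb | hb | hb | ⟨rfl, -⟩
        · exact Or.inl hb
        · exact Or.inr (Or.inl hb)
        · exact Or.inr (Or.inr ⟨hb.1, Or.inl hb.2⟩)
        · exact absurd ha.1 hyX
    have h2 := card_corner_add_card_corner_le (T := T) h.notMem_right
      h'.notMem_right h.notMem_of_left h.notMem_of_right
    by_cases hzY : z ∈ Y
    · -- here `Y ∩ Z` is the far side of a separation of `yz`, and is smaller than `Y`
      have hsep : H.IsEdgeSeparation y z (corner S T Y Z)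
          (Finset.univ \ (Y ∩ Z ∪ corner S T Y Z)) (Y ∩ Z) := by
        have hyc : y ∉ corner S T Y Z := by
          have h3 := h'.notMem_of_left y h'.left_mem
          have h4 := h.notMem_of_right y h.right_mem
          rw [mem_corner]
          tauto
        refine ⟨by simp [hyZ, hyc], by simp [hzY, h'.right_mem], hyz, ?_, ?_, ?_, ?_, ?_⟩
        · intro u
          simp only [Finset.mem_sdiff, Finset.mem_univ, Finset.mem_union, true_and]
          tauto
        · intro u hu
          simp only [Finset.mem_sdiff, Finset.mem_univ, Finset.mem_union, true_and] at hu
          tauto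
        · intro u hu
          simp only [Finset.mem_sdiff, Finset.mem_univ, Finset.mem_union, true_and] at hu
          tauto
        · intro u hu
          rw [Finset.mem_inter] at hu
          exact h.symm.notMem_corner h'.symm hu.1 hu.2
        · intro a ha b hb hab
          simp only [Finset.mem_sdiff, Finset.mem_univ, Finset.mem_union, true_and,
            Finset.mem_inter, not_or] at ha hb
          rcases h.symm.corner_boundary h'.symm hb.1 hb.2 hab.symm with hb | hb | ⟨rfl, -⟩ | hb
          · exact absurd hb ha.1
          · exact absurd hb ha.2
          · exact absurd hb.2 hyZ
          · exact hb.symm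
      have h3 := hmin hy hz (by omega) hsep
      have h4 : (Y ∩ Z).card < Y.card := Finset.card_lt_card
        ⟨Finset.inter_subset_left, fun hsub => hyZ (Finset.mem_inter.1 (hsub h.right_mem)).2⟩
      omega
    · have h3 : k ≤ (corner S T Y Z).card := by
        refine hH.le_card_of_boundary (D := Y ∩ Z)
          ⟨w, Finset.mem_inter.2 ⟨hwY, hwZ⟩⟩ ?_ ⟨x, ?_, ?_⟩ ?_
        · intro w hw
          rw [Finset.mem_inter] at hw
          exact h.symm.notMem_corner h'.symm hw.1 hw.2
        · simp [hxY]
        · exact h.symm.notMem_corner_of_right h.left_mem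
        · intro a ha b hab
          rw [Finset.mem_inter] at ha ⊢
          rcases h.symm.corner_boundary h'.symm ha.1 ha.2 hab with hb | hb | ⟨rfl, -⟩ | ⟨rfl, -⟩
          · exact Or.inl hb
          · exact Or.inr hb
          · exact absurd ha.2 hyZ
          · exact absurd ha.1 hzY
      omega
  have hYk : Y.card < k := by
    rcases hcases with hX | hZ
    · have : X ⊆ T := fun v hv => by
        have := h'.cover v; have := hX v hv; have := hXZ v hv; tauto
      have := Finset.card_le_card this
      omega
    · have : Z ⊆ S := fun v hv => by
        have := h.cover v; have := fun hv' => hZ v hv' hv; have := fun hv' => hXZ v hv' hv; tauto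
      have := Finset.card_le_card this
      omega
  have hsub : Finset.univ.filter (H.Adj y) ⊆ insert x (Y.erase y ∪ S) := by
    intro b hb
    have hb := (Finset.mem_filter.1 hb).2
    have h1 := h.cover b
    have h2 := fun hbX => (h.eq_of_adj b hbX y h.right_mem hb.symm).1
    have h3 := hb.ne'
    simp only [Finset.mem_insert, Finset.mem_union, Finset.mem_erase]
    tauto
  have h1 := Finset.card_le_card hsub
  have h2 := Finset.card_insert_le x (Y.erase y ∪ S)
  have h3 := Finset.card_union_le (Y.erase y) S
  have h4 := Finset.card_erase_add_one h.right_mem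
  have h5 := hdeg' y hy
  omega

end

/-! ### Matchings as graphs -/

section

variable {V : Type*}

/-- A matching encoded as a spanning graph: every vertex has at most one neighbour. The vertices
covered by the matching are those of `N.support`. -/
def IsMatchingGraph (N : SimpleGraph V) : Prop := ∀ a b c, N.Adj a b → N.Adj a c → b = c

theorem hasRemovableMatching_of_isMatchingGraph [Fintype V] {G N : SimpleGraph V} {k : ℕ}
    (hN : N.IsMatchingGraph) (hNG : N ≤ G) (hk : (G \ N).IsVertexConnected k) :
    G.HasRemovableMatching k N.edgeSet.ncard := by
  let M : G.Subgraph :=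
    { verts := N.support
      Adj := N.Adj
      adj_sub := fun h => hNG h
      edge_vert := fun h => ⟨_, h⟩
      symm := N.symm }
  have hM : M.edgeSet = N.edgeSet := by
    ext e
    induction e with
    | _ a b => rfl
  refine ⟨M, ?_, by rw [hM], ?_⟩
  · rintro v ⟨w, hw⟩
    exact ⟨w, hw, fun w' hw' => hN _ _ _ hw' hw⟩
  · have : G.deleteEdges M.edgeSet = G \ N := by
      ext a b
      rw [deleteEdges_adj, sdiff_adj, hM, mem_edgeSet]
    rwa [this]

open Classical in
theorem IsMatchingGraph.card_support [Fintype V] {N : SimpleGraph V} (hN : N.IsMatchingGraph) :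
    (Finset.univ.filter (· ∈ N.support)).card = 2 * N.edgeSet.ncard := by
  have h := N.sum_degrees_eq_twice_card_edges
  rw [← coe_edgeFinset, Set.ncard_coe_finset, ← h, Finset.card_filter]
  refine Finset.sum_congr rfl fun v _ => ?_
  split_ifs with hv
  · obtain ⟨w, hw⟩ := hv
    symm
    rw [← card_neighborFinset_eq_degree, Finset.card_eq_one]
    refine ⟨w, ?_⟩
    ext b
    rw [mem_neighborFinset, Finset.mem_singleton]
    exact ⟨fun hb => hN _ _ _ hb hw, fun hb => hb ▸ hw⟩
  · symm
    rw [← card_neighborFinset_eq_degree, Finset.card_eq_zero, Finset.eq_empty_iff_forall_notMem]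
    intro b hb
    exact hv ⟨b, by simpa using hb⟩

theorem IsMatchingGraph.sup_edge {N : SimpleGraph V} (hN : N.IsMatchingGraph) {x y : V}
    (hx : x ∉ N.support) (hy : y ∉ N.support) : (N ⊔ edge x y).IsMatchingGraph := by
  simp only [mem_support, not_exists] at hx hy
  intro a b c hab hac
  simp only [sup_adj, edge_adj] at hab hac
  have h1 := hN a b c
  have h2 := hx b
  have h3 := hx c
  have h4 := hy b
  have h5 := hy c
  grind

theorem ncard_edgeSet_sup_edge [Finite V] {N : SimpleGraph V} {x y : V} (hxy : x ≠ y)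
    (hx : ¬ N.Adj x y) : (N ⊔ edge x y).edgeSet.ncard = N.edgeSet.ncard + 1 := by
  rw [edgeSet_sup, edgeSet_edge_of_ne hxy, Set.union_singleton,
    Set.ncard_insert_of_notMem (by simpa using hx) (Set.toFinite _)]

theorem ncard_edgeSet_sdiff_edge [Finite V] {N : SimpleGraph V} {x y : V}
    (hxy : N.Adj x y) : (N \ edge x y).edgeSet.ncard + 1 = N.edgeSet.ncard := by
  rw [edgeSet_sdiff, edgeSet_edge_of_ne hxy.ne]
  exact Set.ncard_sdiff_singleton_add_one hxy (Set.toFinite _)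

theorem IsMatchingGraph.mono {N N' : SimpleGraph V} (hN : N.IsMatchingGraph) (h : N' ≤ N) :
    N'.IsMatchingGraph := fun a b c hab hac => hN a b c (h hab) (h hac)

/-- The matching obtained from `N` by exchanging its edge `xy` for the edges `ux` and `yv`. -/
def augment (N : SimpleGraph V) (u x y v : V) : SimpleGraph V :=
  N \ edge x y ⊔ edge u x ⊔ edge y v

variable {N : SimpleGraph V} {u x y v : V}

theorem IsMatchingGraph.augment (hN : N.IsMatchingGraph) (hxy : N.Adj x y)
    (hu : u ∉ N.support) (hv : v ∉ N.support) (huv : u ≠ v) :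
    (N.augment u x y v).IsMatchingGraph := by
  have hx : x ∈ N.support := ⟨y, hxy⟩
  have hy : y ∈ N.support := ⟨x, hxy.symm⟩
  have hxy' := hxy.ne
  refine ((hN.mono sdiff_le).sup_edge ?_ ?_).sup_edge ?_ ?_
  · rintro ⟨w, hw⟩
    exact hu ⟨w, hw.1⟩
  · rintro ⟨w, hw⟩
    obtain rfl := hN x y w hxy hw.1
    exact hw.2 (by simp [edge_adj, hxy'])
  · rintro ⟨w, hw | hw⟩
    · obtain rfl := hN y x w hxy.symm hw.1
      exact hw.2 (by simp [edge_adj, hxy'.symm])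
    · rw [edge_adj] at hw
      grind
  · rintro ⟨w, hw | hw⟩
    · exact hv ⟨w, hw.1⟩
    · rw [edge_adj] at hw
      grind

theorem IsMatchingGraph.ncard_edgeSet_augment [Finite V] (hxy : N.Adj x y)
    (hu : u ∉ N.support) (hv : v ∉ N.support) (huv : u ≠ v) :
    (N.augment u x y v).edgeSet.ncard = N.edgeSet.ncard + 1 := by
  have hx : x ∈ N.support := ⟨y, hxy⟩
  have hy : y ∈ N.support := ⟨x, hxy.symm⟩
  have hxy' := hxy.ne
  rw [SimpleGraph.augment, ncard_edgeSet_sup_edge (by grind), ncard_edgeSet_sup_edge (by grind),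
    ncard_edgeSet_sdiff_edge hxy]
  · exact fun h => hu ⟨x, h.1⟩
  · rintro (h | h)
    · exact hv ⟨y, h.1.symm⟩
    · rw [edge_adj] at h
      grind

theorem augment_le {G : SimpleGraph V} (hN : N ≤ G) (hux : G.Adj u x) (hyv : G.Adj y v) :
    N.augment u x y v ≤ G := by
  intro a b hab
  simp only [augment, sup_adj, sdiff_adj, edge_adj] at hab
  rcases hab with (h | ⟨⟨rfl, rfl⟩ | ⟨rfl, rfl⟩, -⟩) | ⟨⟨rfl, rfl⟩ | ⟨rfl, rfl⟩, -⟩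
  exacts [hN h.1, hux, hux.symm, hyv, hyv.symm]

end

/-! ### Exchanging a matching edge for two edges -/

section

variable {V : Type*} [Fintype V]

/-- Suppose that `H'` contains `H` up to the edges `ux` and `yv`, and contains `xy`. If `H'` is not
`k`-connected although `H` is, then a small separator of `H'` is crossed in `H` by exactly one of
`ux` and `yv`, because the edges `xy` and `uy` of `H'` do not cross it. -/
theorem IsVertexConnected.exists_isEdgeSeparation_of_swap {H H' : SimpleGraph V} {k : ℕ}
    (hH : H.IsVertexConnected k) {u x y v : V}
    (hH' : ∀ a b, H.Adj a b → H'.Adj a b ∨ a = u ∧ b = x ∨ a = x ∧ b = u ∨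
      a = y ∧ b = v ∨ a = v ∧ b = y)
    (hxy : H'.Adj x y) (huy : H.Adj u y) (huv : u ≠ v) (hux : u ≠ x)
    (hcon : ¬ H'.IsVertexConnected k) :
    ∃ S A B : Finset V, S.card < k ∧ (H.IsEdgeSeparation u x S A B ∧ y ∈ S ∨
      H.IsEdgeSeparation y v S A B ∧ x ∉ B) := by
  have huy' : H'.Adj u y := by
    have := hH' u y huy
    have := huy.ne
    have := hxy.ne
    grind
  rw [isVertexConnected_iff] at hH hcon
  push Not at hcon
  obtain ⟨S, A, B, hS, hsep⟩ := hcon hH.1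
  have key : ∃ a ∈ A, ∃ b ∈ B, H.Adj a b := by
    by_contra! hno
    exact hH.2 S A B hS { hsep with not_adj := hno }
  have h1 : ∀ {S A B : Finset V}, H'.IsSeparation S A B → u ∈ A → x ∈ B → H.Adj u x →
      H.IsEdgeSeparation u x S A B ∧ y ∈ S := by
    intro S A B h hu hx hadj
    have hyA : y ∉ A := fun hy => h.not_adj y hy x hx hxy.symm
    have hyB : y ∉ B := fun hy => h.not_adj u hu y hy huy'
    refine ⟨⟨hu, hx, hadj, h.cover, h.notMem_right, h.notMem_of_left, h.notMem_of_right, ?_⟩, ?_⟩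
    · intro a ha b hb hab
      have := hH' a b hab
      have := h.not_adj a ha b hb
      have := h.notMem_right u hu
      grind
    · have := h.cover y; tauto
  have h2 : ∀ {S A B : Finset V}, H'.IsSeparation S A B → y ∈ A → v ∈ B → H.Adj y v →
      H.IsEdgeSeparation y v S A B ∧ x ∉ B := by
    intro S A B h hy hv hadj
    have hxB : x ∉ B := fun hx => h.not_adj y hy x hx hxy.symm
    have huB : u ∉ B := fun hu => h.not_adj y hy u hu huy'.symm
    refine ⟨⟨hy, hv, hadj, h.cover, h.notMem_right, h.notMem_of_left, h.notMem_of_right, ?_⟩, hxB⟩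
    intro a ha b hb hab
    have := hH' a b hab
    have := h.not_adj a ha b hb
    have := h.notMem_right y hy
    grind
  obtain ⟨a, ha, b, hb, hab⟩ := key
  rcases hH' a b hab with h | ⟨rfl, rfl⟩ | ⟨rfl, rfl⟩ | ⟨rfl, rfl⟩ | ⟨rfl, rfl⟩
  · exact absurd h (hsep.not_adj a ha b hb)
  · exact ⟨S, A, B, hS, Or.inl (h1 hsep ha hb hab)⟩
  · exact ⟨S, B, A, hS, Or.inl (h1 hsep.symm hb ha hab.symm)⟩
  · exact ⟨S, A, B, hS, Or.inr (h2 hsep ha hb hab)⟩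
  · exact ⟨S, B, A, hS, Or.inr (h2 hsep.symm hb ha hab.symm)⟩

open Classical in
/-- The properties of the set `U` of unmatched vertices that remain when a `k`-removable matching
cannot be enlarged, `H` being the graph without the matching: `U` induces a forest, vertices of
`U` have degree at least `d`, and all others have lost at most one edge. -/
structure IsSaturated (H : SimpleGraph V) (U : Finset V) (d : ℕ) : Prop where
  exists_le_one : ∀ W ⊆ U, W.Nonempty → ∃ w ∈ W, (W.filter (H.Adj w)).card ≤ 1
  le_card : ∀ t ∈ U, d ≤ (Finset.univ.filter (H.Adj t)).card
  le_card_add_one : ∀ t, d ≤ (Finset.univ.filter (H.Adj t)).card + 1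

open Classical in
/-- A subset of `U` whose neighbours outside it lie in a set `D` with `|D| < d - 1` is empty: its
vertices all have two neighbours inside it. -/
theorem IsSaturated.eq_empty {H : SimpleGraph V} {U : Finset V} {d : ℕ} (hU : H.IsSaturated U d)
    {W D : Finset V} (hW : W ⊆ U) (hN : ∀ t ∈ W, ∀ b, H.Adj t b → b ∈ W ∨ b ∈ D)
    (hD : D.card + 1 < d) : W = ∅ := by
  by_contra hne
  obtain ⟨w, hw, hw1⟩ := hU.exists_le_one W hW (Finset.nonempty_iff_ne_empty.2 hne)
  have hsub : Finset.univ.filter (H.Adj w) ⊆ W.filter (H.Adj w) ∪ D := by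
    intro b hb
    have hb := (Finset.mem_filter.1 hb).2
    have := hN w hw b hb
    simp only [Finset.mem_union, Finset.mem_filter]
    tauto
  have h1 := hU.le_card w (hW hw)
  have h2 := Finset.card_le_card hsub
  have h3 := Finset.card_union_le (W.filter (H.Adj w)) D
  omega

open Classical in
/-- As `IsSaturated.eq_empty`, with one vertex `v` exempted from the condition. -/
theorem IsSaturated.card_le_one {H : SimpleGraph V} {U : Finset V} {d : ℕ}
    (hU : H.IsSaturated U d) {W D : Finset V} {v : V} (hW : W ⊆ U)
    (hN : ∀ t ∈ W, t ≠ v → ∀ b, H.Adj t b → b ∈ W ∨ b ∈ D)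
    (hD : D.card + 1 < d) : W.card ≤ 1 := by
  by_contra! hne
  obtain ⟨w, hw, hwv, hw1⟩ := exists_ne_card_neighbors_le_one hU.exists_le_one W hW hne v
  have hsub : Finset.univ.filter (H.Adj w) ⊆ W.filter (H.Adj w) ∪ D := by
    intro b hb
    have hb := (Finset.mem_filter.1 hb).2
    have := hN w hw hwv b hb
    simp only [Finset.mem_union, Finset.mem_filter]
    tauto
  have h1 := hU.le_card w (hW hw)
  have h2 := Finset.card_le_card hsub
  have h3 := Finset.card_union_le (W.filter (H.Adj w)) D
  omega

open Classical in
/-- If `u, v ∈ U` are adjacent to all but few vertices outside `U`, no separator of fewer than `k`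
vertices that contains `x` is crossed by the edge `yv` alone. For `u ∈ S` the side `A` of `y` has no
vertex of `U`, since those would have too few neighbours outside `U`; so the degree of `y` is too
small. For `u ∉ S` the vertices of the side `B` outside `U` are among those `u` misses, so the
forest induced on `B ∩ U` would have `v` as its only leaf. -/
theorem IsSaturated.false_of_isEdgeSeparation {H : SimpleGraph V} {U : Finset V} {d k : ℕ}
    (hU : H.IsSaturated U d) (hk : k ≤ 3) {u x y v : V} (hu : u ∈ U) (hv : v ∈ U)
    (hx : x ∉ U) (hy : y ∉ U) (huv : u ≠ v) (huy : H.Adj u y) (hxy : ¬ H.Adj x y)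
    (hmu : (Uᶜ.filter (¬ H.Adj u ·)).card + k + 1 ≤ d)
    (hmv : (Uᶜ.filter (¬ H.Adj v ·)).card + 2 * k ≤ d + 1)
    {S A B : Finset V} (hS : S.card < k) (h : H.IsEdgeSeparation y v S A B) (hxS : x ∈ S) :
    False := by
  have hux : x ≠ u := fun h => hx (h ▸ hu)
  by_cases huS : u ∈ S
  · have hSsub : {x, u} ⊆ S := by
      intro a ha
      simp only [Finset.mem_insert, Finset.mem_singleton] at ha
      rcases ha with rfl | rfl <;> assumption
    have hScard : 2 ≤ S.card := by
      rw [← Finset.card_pair hux]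
      exact Finset.card_le_card hSsub
    have hSeq : {x, u} = S := Finset.eq_of_subset_of_card_le hSsub (by
      rw [Finset.card_pair hux]; omega)
    have hA : ∀ a ∈ A, a ∉ U → a = y ∨ a ∈ Uᶜ.filter (¬ H.Adj v ·) := by
      intro a ha haU
      have h1 := h.eq_of_adj a ha v h.right_mem
      rw [adj_comm] at h1
      simp only [Finset.mem_filter, Finset.mem_compl]
      tauto
    have hempty : A ∩ U = ∅ := by
      refine hU.eq_empty (D := insert y (S ∪ Uᶜ.filter (¬ H.Adj v ·)))
        Finset.inter_subset_right ?_ ?_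
      · intro t ht b hb
        rw [Finset.mem_inter] at ht
        have h1 : t ≠ y := fun h => hy (h ▸ ht.2)
        have h2 := h.cover b
        have h3 := fun hbB => (h.eq_of_adj t ht.1 b hbB hb).1
        have h4 := hA b
        simp only [Finset.mem_inter, Finset.mem_insert, Finset.mem_union]
        tauto
      · have h1 := Finset.card_insert_le y (S ∪ Uᶜ.filter (¬ H.Adj v ·))
        have h2 := Finset.card_union_le S (Uᶜ.filter (¬ H.Adj v ·))
        omega
    have hsub : Finset.univ.filter (H.Adj y) ⊆
        insert v (insert u (Uᶜ.filter (¬ H.Adj v ·))) := by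
      intro b hb
      have hb := (Finset.mem_filter.1 hb).2
      have h1 := hb.ne'
      have h2 := h.cover b
      have h3 := fun hbB => (h.eq_of_adj y h.left_mem b hbB hb).2
      have h4 := hA b
      have h5 : b ∈ A → b ∉ U := fun hbA hbU => by
        have := Finset.mem_inter.2 ⟨hbA, hbU⟩
        rw [hempty] at this
        simp at this
      have h6 : b ∈ S → b = u := fun hbS => by
        rw [← hSeq, Finset.mem_insert, Finset.mem_singleton] at hbS
        rcases hbS with rfl | h
        · exact absurd hb.symm hxy
        · exact h
      simp only [Finset.mem_insert]
      tauto
    have h1 := hU.le_card_add_one y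
    have h2 := Finset.card_le_card hsub
    have h3 := Finset.card_insert_le v (insert u (Uᶜ.filter (¬ H.Adj v ·)))
    have h4 := Finset.card_insert_le u (Uᶜ.filter (¬ H.Adj v ·))
    omega
  · have huA : u ∈ A := by
      have h1 := h.cover u
      have h2 := fun huB => (h.eq_of_adj y h.left_mem u huB huy.symm).2
      tauto
    have huy' := huy.ne
    have hB : ∀ b ∈ B, b ∉ U → b ∈ Uᶜ.filter (¬ H.Adj u ·) := by
      intro b hb hbU
      have h1 := h.eq_of_adj u huA b hb
      simp only [Finset.mem_filter, Finset.mem_compl]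
      tauto
    have hDcard := Finset.card_union_le S (Uᶜ.filter (¬ H.Adj u ·))
    have hle : (B ∩ U).card ≤ 1 := by
      refine hU.card_le_one (D := S ∪ Uᶜ.filter (¬ H.Adj u ·)) (v := v)
        Finset.inter_subset_right ?_ (by omega)
      intro t ht htv b hb
      rw [Finset.mem_inter] at ht
      have h2 := h.cover b
      have h3 := fun hbA => (h.eq_of_adj b hbA t ht.1 hb.symm).2
      have h4 := hB b
      simp only [Finset.mem_inter, Finset.mem_union]
      tauto
    have hvB : v ∈ B ∩ U := Finset.mem_inter.2 ⟨h.right_mem, hv⟩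
    have hsub : Finset.univ.filter (H.Adj v) ⊆
        insert y ((B ∩ U).erase v ∪ (S ∪ Uᶜ.filter (¬ H.Adj u ·))) := by
      intro b hb
      have hb := (Finset.mem_filter.1 hb).2
      have h1 := hb.ne'
      have h2 := h.cover b
      have h3 := fun hbA => (h.eq_of_adj b hbA v h.right_mem hb.symm).1
      have h4 := hB b
      simp only [Finset.mem_insert, Finset.mem_union, Finset.mem_inter, Finset.mem_erase]
      rcases h2 with h2 | h2 | h2
      · exact Or.inl (h3 h2)
      · by_cases hbU : b ∈ U
        · exact Or.inr (Or.inl ⟨h1, h2, hbU⟩)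
        · exact Or.inr (Or.inr (Or.inr (h4 h2 hbU)))
      · exact Or.inr (Or.inr (Or.inl h2))
    have h1 := hU.le_card v hv
    have h2 := Finset.card_le_card hsub
    have h3 := Finset.card_insert_le y ((B ∩ U).erase v ∪ (S ∪ Uᶜ.filter (¬ H.Adj u ·)))
    have h4 := Finset.card_union_le ((B ∩ U).erase v) (S ∪ Uᶜ.filter (¬ H.Adj u ·))
    have h5 := Finset.card_erase_add_one hvB
    omega

open Classical in
/-- Exchanging the matching edge `xy` for `ux` and `yv` preserves `k`-connectivity if `u` and `v`
are both adjacent to `x` and `y` and miss few vertices outside `U`. -/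
theorem IsSaturated.isVertexConnected_of_swap {H H' : SimpleGraph V} {U : Finset V} {d k : ℕ}
    (hU : H.IsSaturated U d) (hH : H.IsVertexConnected k) (hk : k ≤ 3) {u x y v : V}
    (hu : u ∈ U) (hv : v ∈ U) (hx : x ∉ U) (hy : y ∉ U) (huv : u ≠ v)
    (hux : H.Adj u x) (huy : H.Adj u y) (hvx : H.Adj v x)
    (hxy : ¬ H.Adj x y)
    (hmu : (Uᶜ.filter (¬ H.Adj u ·)).card + k + 1 ≤ d)
    (hmu' : (Uᶜ.filter (¬ H.Adj u ·)).card + 2 * k ≤ d + 1)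
    (hmv : (Uᶜ.filter (¬ H.Adj v ·)).card + k + 1 ≤ d)
    (hmv' : (Uᶜ.filter (¬ H.Adj v ·)).card + 2 * k ≤ d + 1)
    (hH' : ∀ a b, H.Adj a b → H'.Adj a b ∨ a = u ∧ b = x ∨ a = x ∧ b = u ∨
      a = y ∧ b = v ∨ a = v ∧ b = y)
    (hxy' : H'.Adj x y) : H'.IsVertexConnected k := by
  by_contra hcon
  obtain ⟨S, A, B, hS, ⟨h, hyS⟩ | ⟨h, hxB⟩⟩ :=
    hH.exists_isEdgeSeparation_of_swap hH' hxy' huy huv hux.ne hcon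
  · exact hU.false_of_isEdgeSeparation hk hv hu hy hx huv.symm hvx (fun h => hxy h.symm)
      hmv hmu' hS h.symm hyS
  · have hxS : x ∈ S := by
      have h1 := h.cover x
      have h2 := fun hxA => (h.eq_of_adj x hxA v h.right_mem hvx.symm).1
      have := hxy'.ne
      tauto
    exact hU.false_of_isEdgeSeparation hk hu hv hx hy huv huy hxy hmu hmv' hS h hxS

open Classical in
/-- The exchange for minimum degree four and matching edges `xy`, `zw`, when no matching edge has
both ends adjacent to `u` and `v`: here `u` misses `x`, `v` misses `z`, and `xy` is exchanged for
`vx` and `yu`. As `k ≤ 2`, a separator is at most one vertex, which has to be `y`, `v` or `w`. -/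
theorem IsSaturated.isVertexConnected_of_swap_four {H H' : SimpleGraph V} {U : Finset V} {k : ℕ}
    (hU : H.IsSaturated U 4) (hH : H.IsVertexConnected k) (hk : k ≤ 2) {u v x y z w : V}
    (hu : u ∈ U) (hv : v ∈ U) (huv : u ≠ v) (hUc : ∀ t, t ∉ U ↔ t = x ∨ t = y ∨ t = z ∨ t = w)
    (hzy : z ≠ y) (hwy : w ≠ y) (hwx : w ≠ x)
    (hvx : H.Adj v x) (hvy : H.Adj v y) (hvw : H.Adj v w)
    (huz : H.Adj u z) (huw : H.Adj u w) (hux : ¬ H.Adj u x)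
    (hH' : ∀ a b, H.Adj a b → H'.Adj a b ∨ a = v ∧ b = x ∨ a = x ∧ b = v ∨
      a = y ∧ b = u ∨ a = u ∧ b = y)
    (hxy' : H'.Adj x y) : H'.IsVertexConnected k := by
  have hxU : x ∉ U := (hUc x).2 (by tauto)
  have hyU : y ∉ U := (hUc y).2 (by tauto)
  have hzU : z ∉ U := (hUc z).2 (by tauto)
  have hwU : w ∉ U := (hUc w).2 (by tauto)
  have hxy := hxy'.ne
  -- a two-element set cannot contain the neighbourhood of `x`
  have hdegx : ∀ p q : V, ¬ ∀ b, H.Adj x b → b = p ∨ b = q := by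
    intro p q hall
    have h1 : Finset.univ.filter (H.Adj x) ⊆ {p, q} := fun b hb => by
      simpa using hall b (Finset.mem_filter.1 hb).2
    have h2 := Finset.card_le_card h1
    have h3 := Finset.card_le_two (a := p) (b := q)
    have h4 := hU.le_card_add_one x
    omega
  have hpair : ∀ p q : V, ({p, q} : Finset V).card + 1 < 4 := fun p q => by
    have := Finset.card_le_two (a := p) (b := q)
    omega
  by_contra hcon
  obtain ⟨S, A, B, hS, h⟩ :=
    hH.exists_isEdgeSeparation_of_swap hH' hxy' hvy huv.symm hvx.ne hcon
  have hS1 : ∀ a ∈ S, ∀ b ∈ S, a = b := fun a ha b hb =>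
    Finset.card_le_one.1 (by omega) a ha b hb
  rcases h with ⟨h, hyS⟩ | ⟨h, hxB⟩
  · -- the edge `vx` is the only one between `A` and `B`
    have hwA : w ∈ A := by
      have h1 := h.cover w
      have h2 := fun hwB => (h.eq_of_adj v h.left_mem w hwB hvw).2
      have h3 := fun hwS => hS1 w hwS y hyS
      tauto
    have huA : u ∈ A := by
      have h1 := h.cover u
      have h2 := fun huB => (h.eq_of_adj w hwA u huB huw.symm).2
      have h3 := fun huS => hS1 u huS y hyS
      have h4 : u ≠ y := fun h => hyU (h ▸ hu)
      have h5 : u ≠ x := fun h => hxU (h ▸ hu)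
      tauto
    have hzB : z ∉ B := fun hzB => huv (h.eq_of_adj u huA z hzB huz).1
    have hwB := h.notMem_right w hwA
    have hB : B ∩ U = ∅ := by
      refine hU.eq_empty (D := {x, y}) Finset.inter_subset_right ?_ (hpair _ _)
      intro t ht b hb
      rw [Finset.mem_inter] at ht
      have h1 : b ∉ A := fun hbA => hxU ((h.eq_of_adj b hbA t ht.1 hb.symm).2 ▸ ht.2)
      have h2 := h.cover b
      have h3 := fun hbS => hS1 b hbS y hyS
      have h4 := hUc b
      simp only [Finset.mem_inter, Finset.mem_insert, Finset.mem_singleton]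
      grind
    refine hdegx v y fun b hb => ?_
    have h1 := fun hbA => (h.eq_of_adj b hbA x h.right_mem hb.symm).1
    have h2 := h.cover b
    have h3 := fun hbS => hS1 b hbS y hyS
    have h4 := hUc b
    have h5 : b ∈ B → b ∉ U := fun hbB hbU => by
      have := Finset.mem_inter.2 ⟨hbB, hbU⟩
      rw [hB] at this
      simp at this
    have h6 := hb.ne
    grind
  · -- the edge `yu` is the only one between `A` and `B`
    by_cases hvS : v ∈ S
    · have hwB : w ∈ B := by
        have h1 := h.cover w
        have h2 := fun hwA => (h.eq_of_adj w hwA u h.right_mem huw.symm).1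
        have h3 := fun hwS => hS1 w hwS v hvS
        have h4 : w ≠ v := fun h => hwU (h ▸ hv)
        tauto
      have hzB : z ∈ B := by
        have h1 := h.cover z
        have h2 := fun hzA => (h.eq_of_adj z hzA u h.right_mem huz.symm).1
        have h3 := fun hzS => hS1 z hzS v hvS
        have h4 : z ≠ v := fun h => hzU (h ▸ hv)
        tauto
      have hzA := h.symm.notMem_right z hzB
      have hwA := h.symm.notMem_right w hwB
      have hxA : x ∈ A := by
        have h1 := h.cover x
        have h3 := fun hxS => hS1 x hxS v hvS
        have h4 : x ≠ v := fun h => hxU (h ▸ hv)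
        tauto
      have hle : (insert v (A ∩ U)).card ≤ 1 := by
        refine hU.card_le_one (D := {x, y}) (v := v) ?_ ?_ (hpair _ _)
        · exact Finset.insert_subset hv Finset.inter_subset_right
        · intro t ht htv b hb
          rw [Finset.mem_insert, Finset.mem_inter] at ht
          replace ht := ht.resolve_left htv
          have h1 : b ∉ B := fun hbB => hyU ((h.eq_of_adj t ht.1 b hbB hb).1 ▸ ht.2)
          have h2 := h.cover b
          have h3 := fun hbS => hS1 b hbS v hvS
          have h4 := hUc b
          simp only [Finset.mem_inter, Finset.mem_insert, Finset.mem_singleton]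
          grind
      have hA : ∀ a ∈ A, a ∉ U := by
        intro a ha haU
        have h1 := Finset.card_le_one.1 hle v (Finset.mem_insert_self _ _) a
          (Finset.mem_insert_of_mem (Finset.mem_inter.2 ⟨ha, haU⟩))
        exact h.notMem_of_left a ha (h1 ▸ hvS)
      refine hdegx v y fun b hb => ?_
      have h1 := fun hbB => (h.eq_of_adj x hxA b hbB hb).1
      have h2 := h.cover b
      have h3 := fun hbS => hS1 b hbS v hvS
      have h4 := hUc b
      have h5 := hA b
      have h6 := hb.ne
      grind
    · have hvA : v ∈ A := by
        have h1 := h.cover v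
        have h2 := fun hvB => (h.eq_of_adj y h.left_mem v hvB hvy.symm).2
        have := huv.symm
        tauto
      have hwS : w ∈ S := by
        have h1 := h.cover w
        have h2 := fun hwA => (h.eq_of_adj w hwA u h.right_mem huw.symm).1
        have h3 := fun hwB => (h.eq_of_adj v hvA w hwB hvw).1
        have h4 : v ≠ y := fun h => hyU (h ▸ hv)
        tauto
      have hxA : x ∈ A := by
        have h1 := h.cover x
        have h3 := fun hxS => hS1 x hxS w hwS
        have := hwx.symm
        tauto
      have hxB' := h.notMem_right x hxA
      have hyB := h.notMem_right y h.left_mem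
      have hle : (B ∩ U).card ≤ 1 := by
        refine hU.card_le_one (D := {z, w}) (v := u) Finset.inter_subset_right ?_ (hpair _ _)
        intro t ht htu b hb
        rw [Finset.mem_inter] at ht
        have h1 : b ∉ A := fun hbA => htu (h.eq_of_adj b hbA t ht.1 hb.symm).2
        have h2 := h.cover b
        have h3 := fun hbS => hS1 b hbS w hwS
        have h4 := hUc b
        simp only [Finset.mem_inter, Finset.mem_insert, Finset.mem_singleton]
        grind
      have huB : u ∈ B ∩ U := Finset.mem_inter.2 ⟨h.right_mem, hu⟩
      have hsub : Finset.univ.filter (H.Adj u) ⊆ insert y {z, w} := by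
        intro b hb
        have hb := (Finset.mem_filter.1 hb).2
        have h1 := fun hbA => (h.eq_of_adj b hbA u h.right_mem hb.symm).1
        have h2 := h.cover b
        have h3 := fun hbS => hS1 b hbS w hwS
        have h4 := hUc b
        have h5 : b ∈ B → b ∉ U := fun hbB hbU => hb.ne
          (Finset.card_le_one.1 hle u huB b (Finset.mem_inter.2 ⟨hbB, hbU⟩))
        simp only [Finset.mem_insert, Finset.mem_singleton]
        grind
      have h1 := hU.le_card u hu
      have h2 := Finset.card_le_card hsub
      have h3 := Finset.card_insert_le y {z, w}
      have h4 := hpair z w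
      omega

end

/-! ### Connectivity one and minimum degree two -/

section

variable {V : Type*}

theorem isVertexConnected_one_iff [Fintype V] {H : SimpleGraph V} :
    H.IsVertexConnected 1 ↔ 1 < Fintype.card V ∧ H.Connected := by
  refine and_congr_right fun _ => ?_
  have huniv : {v : V | v ∉ (∅ : Finset V)} = Set.univ := by ext; simp
  constructor
  · intro h
    have h0 := h ∅ (by simp)
    rw [huniv] at h0
    exact (induceUnivIso H).connected_iff.1 h0
  · intro h S hS
    obtain rfl : S = ∅ := Finset.card_eq_zero.1 (by omega)
    rw [huniv]
    exact (induceUnivIso H).connected_iff.2 h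

theorem Connected.of_forall_adj_reachable {H K : SimpleGraph V} (hH : H.Connected)
    (h : ∀ a b, H.Adj a b → K.Reachable a b) : K.Connected := by
  have : Nonempty V := hH.nonempty
  refine ⟨fun a b => ?_⟩
  obtain ⟨p⟩ := hH.preconnected a b
  induction p with
  | nil => exact Reachable.refl _
  | cons hadj _ ih => exact (h _ _ hadj).trans ih

/-- A connected graph that is not a tree has an edge that is not a bridge. -/
theorem Connected.exists_adj_connected_sdiff_edge {H : SimpleGraph V} (hH : H.Connected)
    (hac : ¬ H.IsTree) : ∃ x y, H.Adj x y ∧ (H \ edge x y).Connected := by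
  have hac : ¬ H.IsAcyclic := fun h => hac ⟨hH, h⟩
  rw [isAcyclic_iff_forall_adj_isBridge] at hac
  push Not at hac
  obtain ⟨x, y, hxy, hb⟩ := hac
  refine ⟨x, y, hxy, ?_⟩
  have := hH.connected_delete_edge_of_not_isBridge hb
  rwa [← edgeSet_edge_of_ne hxy.ne, deleteEdges_edgeSet] at this

/-- A connected `2`-regular graph is a cycle: it contains a cycle, and no edge leaves that cycle. -/
theorem Connected.isCycleGraph [Fintype V] {G : SimpleGraph V} [DecidableRel G.Adj]
    (hG : G.Connected) (hdeg : ∀ v, G.degree v = 2) : G.IsCycleGraph := by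
  classical
  have hnt : ¬ G.IsAcyclic := by
    intro hac
    have h1 := IsTree.card_edgeFinset ⟨hG, hac⟩
    have h2 := G.sum_degrees_eq_twice_card_edges
    simp only [hdeg, Finset.sum_const, Finset.card_univ, smul_eq_mul] at h2
    omega
  rw [isAcyclic_iff_free_cycleGraph] at hnt
  push Not at hnt
  obtain ⟨n, hn, hfree⟩ := hnt
  obtain ⟨m, rfl⟩ := Nat.exists_eq_add_of_le' hn
  obtain ⟨f, hf⟩ := hfree
  -- both sides are `2`-regular, so a neighbour of an image vertex is an image vertex
  have hlift : ∀ i w, G.Adj (f i) w → ∃ j, (cycleGraph (m + 3)).Adj i j ∧ f j = w := by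
    intro i w hw
    have hsub : ((cycleGraph (m + 3)).neighborFinset i).image f ⊆ G.neighborFinset (f i) := by
      intro b hb
      obtain ⟨j, hj, rfl⟩ := Finset.mem_image.1 hb
      rw [mem_neighborFinset] at hj ⊢
      exact f.map_rel hj
    have heq := Finset.eq_of_subset_of_card_le hsub (by
      rw [Finset.card_image_of_injective _ hf, card_neighborFinset_eq_degree,
        card_neighborFinset_eq_degree, hdeg, cycleGraph_degree_three_le])
    have hmem : w ∈ G.neighborFinset (f i) := by rwa [mem_neighborFinset]
    rw [← heq, Finset.mem_image] at hmem
    obtain ⟨j, hj, hjw⟩ := hmem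
    exact ⟨j, by rwa [mem_neighborFinset] at hj, hjw⟩
  have hsurj : Function.Surjective f := by
    intro w
    obtain ⟨p⟩ := hG.preconnected (f 0) w
    have key : ∀ (a b : V), G.Walk a b → (∃ i, f i = a) → ∃ i, f i = b := by
      intro a b p
      induction p with
      | nil => exact id
      | cons hadj _ ih =>
        rintro ⟨i, rfl⟩
        obtain ⟨j, -, hj⟩ := hlift i _ hadj
        exact ih ⟨j, hj⟩
    exact key _ _ p ⟨0, rfl⟩
  refine ⟨m + 3, hn, ⟨RelIso.symm ⟨Equiv.ofBijective f ⟨hf, hsurj⟩, ?_⟩⟩⟩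
  intro i j
  refine ⟨fun h => ?_, fun h => f.map_rel h⟩
  obtain ⟨j', hj', hjj⟩ := hlift i _ h
  exact hf hjj ▸ hj'

theorem hasRemovableMatching_two_of_disjoint [Fintype V] {G : SimpleGraph V} {a b c d : V}
    (hab : G.Adj a b) (hcd : G.Adj c d) (hac : a ≠ c) (had : a ≠ d) (hbc : b ≠ c) (hbd : b ≠ d)
    (hcon : (G \ (edge a b ⊔ edge c d)).Connected) : G.HasRemovableMatching 1 2 := by
  have hcard : (edge a b ⊔ edge c d).edgeSet.ncard = 2 := by
    rw [ncard_edgeSet_sup_edge hcd.ne, edgeSet_edge_of_ne hab.ne, Set.ncard_singleton]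
    rw [edge_adj]
    grind
  rw [← hcard]
  refine hasRemovableMatching_of_isMatchingGraph ?_ ?_ ?_
  · intro x y z hxy hxz
    simp only [sup_adj, edge_adj] at hxy hxz
    grind
  · intro x y hxy
    simp only [sup_adj, edge_adj] at hxy
    have := hab.symm
    have := hcd.symm
    grind
  · have : Nontrivial V := ⟨a, b, hab.ne⟩
    exact isVertexConnected_one_iff.2 ⟨Fintype.one_lt_card, hcon⟩

/-- Two edges `ab` and `ac` whose joint deletion leaves `H` connected. If a path of `H` from `b` to
`a` starts with `bq` and avoids `c`, then `ab` may be kept and `bq` deleted instead, and `bq` is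
disjoint from `ac`. -/
theorem hasRemovableMatching_two_of_isPath [Fintype V] {G H : SimpleGraph V} {a b c : V}
    (hH : H = G \ (edge a b ⊔ edge a c)) (hab : G.Adj a b) (hac : G.Adj a c) (hbc : b ≠ c)
    (hcon : H.Connected) {P : H.Walk b a} (hP : P.IsPath) (hc : c ∉ P.support) :
    G.HasRemovableMatching 1 2 := by
  subst hH
  cases P with
  | nil => exact absurd rfl hab.ne
  | @cons _ q _ hbq p =>
    obtain ⟨-, hbp⟩ := (Walk.cons_isPath_iff _ _).1 hP
    have hqc : q ≠ c := by
      rintro rfl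
      exact hc (by simp)
    have hadj : ∀ s t, (G \ (edge a b ⊔ edge a c)).Adj s t →
        (G \ (edge a c ⊔ edge q b)).Adj s t ∨ s = q ∧ t = b ∨ s = b ∧ t = q := by
      intro s t hst
      simp only [sdiff_adj, sup_adj, edge_adj] at hst ⊢
      tauto
    have hqa : q ≠ a := by
      rintro rfl
      simp only [sdiff_adj, sup_adj, edge_adj] at hbq
      have := hab.ne'
      tauto
    have hK : (G \ (edge a c ⊔ edge q b)).Adj a b := by
      have := hab.ne
      simp only [sdiff_adj, sup_adj, edge_adj]
      grind
    have hqaR : (G \ (edge a c ⊔ edge q b)).Reachable q a := by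
      have key : ∀ s t, ∀ p : (G \ (edge a b ⊔ edge a c)).Walk s t, b ∉ p.support →
          (G \ (edge a c ⊔ edge q b)).Reachable s t := by
        intro s t p
        induction p with
        | nil => exact fun _ => Reachable.refl _
        | @cons s w t hsw p ih =>
          intro hb
          rw [Walk.support_cons, List.mem_cons, not_or] at hb
          refine Reachable.trans ?_ (ih hb.2)
          have hw : b ≠ w := fun h => hb.2 (h ▸ p.start_mem_support)
          have := hadj s w hsw
          exact Adj.reachable (by grind)
      exact key _ _ p hbp
    have hqb := hqaR.trans hK.reachable
    refine hasRemovableMatching_two_of_disjoint hac hbq.1.symm hqa.symm hab.ne hqc.symm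
      hbc.symm ?_
    refine hcon.of_forall_adj_reachable fun s t hst => ?_
    rcases hadj s t hst with h | ⟨rfl, rfl⟩ | ⟨rfl, rfl⟩
    exacts [h.reachable, hqb, hqb.symm]

theorem hasRemovableMatching_two_of_common [Fintype V] {G : SimpleGraph V} {a b c : V}
    (hab : G.Adj a b) (hac : G.Adj a c) (hbc : b ≠ c)
    (hcon : (G \ (edge a b ⊔ edge a c)).Connected) : G.HasRemovableMatching 1 2 := by
  classical
  obtain ⟨P, hP⟩ := hcon.exists_isPath b a
  by_cases hc : c ∈ P.support
  · -- the part of the path from `c` on avoids `b`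
    obtain ⟨q, r, -, hr, rfl⟩ := hP.mem_support_iff_exists_append.1 hc
    refine hasRemovableMatching_two_of_isPath (by rw [sup_comm]) hac hab hbc.symm hcon hr
      fun hb => ?_
    exact hP.ne_of_mem_support_of_append hbc q.start_mem_support hb rfl
  · exact hasRemovableMatching_two_of_isPath rfl hab hac hbc hcon hP hc

/-- Minimum degree two and connectivity one: a graph that is not a cycle has more edges than
vertices, so that two edges can be deleted without disconnecting it. -/
theorem hasRemovableMatching_one_two [Fintype V] {G : SimpleGraph V} [DecidableRel G.Adj]
    (hG : G.Connected) (hdeg : ∀ v, 2 ≤ G.degree v) (hcyc : ¬ G.IsCycleGraph) :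
    G.HasRemovableMatching 1 2 := by
  classical
  have hcard : Fintype.card V < G.edgeSet.ncard := by
    have h2 := G.sum_degrees_eq_twice_card_edges
    obtain ⟨w, hw⟩ : ∃ w, G.degree w ≠ 2 := by
      by_contra! h
      exact hcyc (hG.isCycleGraph h)
    have h3 : ∑ _v : V, 2 < ∑ v, G.degree v := Finset.sum_lt_sum (fun v _ => hdeg v)
      ⟨w, Finset.mem_univ _, lt_of_le_of_ne (hdeg w) hw.symm⟩
    rw [Finset.sum_const, Finset.card_univ, smul_eq_mul] at h3
    rw [← coe_edgeFinset, Set.ncard_coe_finset]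
    omega
  have hnt : ∀ {H : SimpleGraph V}, Fintype.card V ≤ H.edgeSet.ncard → ¬ H.IsTree := by
    intro H hH hT
    have := hT.card_edgeFinset
    rw [← coe_edgeFinset, Set.ncard_coe_finset] at hH
    omega
  obtain ⟨a, b, hab, hcon⟩ := hG.exists_adj_connected_sdiff_edge (hnt hcard.le)
  have hcard' := ncard_edgeSet_sdiff_edge hab
  obtain ⟨c, d, hcd, hcon'⟩ := hcon.exists_adj_connected_sdiff_edge (hnt (by omega))
  rw [sdiff_sdiff_left] at hcon'
  simp only [sdiff_adj, edge_adj] at hcd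
  have hne := hcd.1.ne
  by_cases hac : a = c
  · subst hac
    exact hasRemovableMatching_two_of_common hab hcd.1 (by grind) hcon'
  by_cases had : a = d
  · subst had
    rw [edge_comm c a] at hcon'
    exact hasRemovableMatching_two_of_common hab hcd.1.symm (by grind) hcon'
  by_cases hbc : b = c
  · subst hbc
    rw [edge_comm a b] at hcon'
    exact hasRemovableMatching_two_of_common hab.symm hcd.1 (by grind) hcon'
  by_cases hbd : b = d
  · subst hbd
    rw [edge_comm a b, edge_comm c b] at hcon'
    exact hasRemovableMatching_two_of_common hab.symm hcd.1.symm (by grind) hcon'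
  exact hasRemovableMatching_two_of_disjoint hab hcd.1 hac had hbc hbd hcon'

end

/-! ### Enlarging a removable matching -/

section

variable {V : Type*}

open Classical in
/-- Let `P` and `Q` hold for at most `|X| + 1 - d` vertices of the set `X` of matched vertices, and
let every edge of the matching have an end where `P` or `Q` holds. Then `d = 4` and the matching consists of two
edges `xy` and `zw`, where `x` is the only vertex with `P` and `z` the only one with `Q`. -/
theorem IsMatchingGraph.exists_of_cover {N : SimpleGraph V} (hN : N.IsMatchingGraph)
    {X : Finset V} (hX : ∀ {t}, t ∈ X ↔ t ∈ N.support) {d : ℕ} (hd : 3 ≤ d) (hXd : X.card ≤ d)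
    {P Q : V → Prop} (hP : (X.filter P).card + d ≤ X.card + 1)
    (hQ : (X.filter Q).card + d ≤ X.card + 1)
    (hPQ : ∀ x y, N.Adj x y → P x ∨ P y ∨ Q x ∨ Q y) :
    d = 4 ∧ ∃ x y z w, N.Adj x y ∧ N.Adj z w ∧ P x ∧
      (∀ t, t ∈ X ↔ t = x ∨ t = y ∨ t = z ∨ t = w) ∧ z ≠ x ∧ z ≠ y ∧ w ≠ x ∧ w ≠ y ∧
      (∀ t ∈ X, P t → t = x) ∧ (∀ t ∈ X, Q t → t = z) := by
  have hleft : ∀ {x y}, N.Adj x y → x ∈ X := fun hxy => hX.2 ⟨_, hxy⟩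
  have huniq : ∀ R : V → Prop, (X.filter R).card + d ≤ X.card + 1 → ∀ x ∈ X, R x →
      ∀ t ∈ X, R t → t = x := fun R hR x hx hRx t ht hRt =>
    Finset.card_le_one.1 (by omega) t (Finset.mem_filter.2 ⟨ht, hRt⟩) x
      (Finset.mem_filter.2 ⟨hx, hRx⟩)
  have hpos : ∀ R : V → Prop, (X.filter R).card + d ≤ X.card + 1 → ∀ x ∈ X, R x →
      d ≤ X.card := fun R hR x hx hRx => by
    have := Finset.card_pos.2 ⟨x, Finset.mem_filter.2 ⟨hx, hRx⟩⟩
    omega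
  -- if `R` holds somewhere then `|X| ≥ d ≥ 3`, so no two vertices exhaust `X`
  have hsmall : ∀ R : V → Prop, (X.filter R).card + d ≤ X.card + 1 → ∀ x ∈ X, R x →
      ∀ p q, ¬ ∀ t ∈ X, t = p ∨ t = q := by
    intro R hR x hx hRx p q hall
    have h1 := hpos R hR x hx hRx
    have h2 : X ⊆ {p, q} := fun t ht => by simpa using hall t ht
    have h3 := (Finset.card_le_card h2).trans Finset.card_le_two
    omega
  have hsingle : ∀ R : V → Prop, (X.filter R).card + d ≤ X.card + 1 →
      ¬ ∀ x y, N.Adj x y → R x ∨ R y := by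
    intro R hR hall
    have key : ∀ x y, N.Adj x y → ¬ R x := by
      intro x y hxy hRx
      refine hsmall R hR x (hleft hxy) hRx x y fun t ht => ?_
      obtain ⟨t', ht'⟩ := hX.1 ht
      rcases hall t t' ht' with h | h
      · exact Or.inl (huniq R hR x (hleft hxy) hRx t ht h)
      · obtain rfl := huniq R hR x (hleft hxy) hRx t' (hleft ht'.symm) h
        exact Or.inr (hN _ _ _ ht'.symm hxy)
    obtain ⟨t, ht⟩ := Finset.card_pos.1 (show 0 < X.card by omega)
    obtain ⟨t', ht'⟩ := hX.1 ht
    rcases hall t t' ht' with h | h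
    exacts [key _ _ ht' h, key _ _ ht'.symm h]
  obtain ⟨x, hxX, hPx⟩ : ∃ x ∈ X, P x := by
    by_contra! hno
    refine hsingle Q hQ fun x y hxy => ?_
    have h1 := hno x (hleft hxy)
    have h2 := hno y (hleft hxy.symm)
    have := hPQ x y hxy
    tauto
  obtain ⟨z, hzX, hQz⟩ : ∃ z ∈ X, Q z := by
    by_contra! hno
    refine hsingle P hP fun x y hxy => ?_
    have h1 := hno x (hleft hxy)
    have h2 := hno y (hleft hxy.symm)
    have := hPQ x y hxy
    tauto
  have hPu := huniq P hP x hxX hPx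
  have hQu := huniq Q hQ z hzX hQz
  obtain ⟨y, hxy⟩ := hX.1 hxX
  obtain ⟨w, hzw⟩ := hX.1 hzX
  have hcover : ∀ t ∈ X, t = x ∨ t = y ∨ t = z ∨ t = w := by
    intro t ht
    obtain ⟨t', ht'⟩ := hX.1 ht
    rcases hPQ t t' ht' with h | h | h | h
    · exact Or.inl (hPu t ht h)
    · obtain rfl := hPu t' (hleft ht'.symm) h
      exact Or.inr (Or.inl (hN _ _ _ ht'.symm hxy))
    · exact Or.inr (Or.inr (Or.inl (hQu t ht h)))
    · obtain rfl := hQu t' (hleft ht'.symm) h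
      exact Or.inr (Or.inr (Or.inr (hN _ _ _ ht'.symm hzw)))
  have hzx : z ≠ x := by
    rintro rfl
    obtain rfl := hN _ _ _ hxy hzw
    exact hsmall P hP z hxX hPx z y fun t ht => by have := hcover t ht; tauto
  have hzy : z ≠ y := by
    rintro rfl
    obtain rfl := hN _ _ _ hxy.symm hzw
    exact hsmall P hP x hxX hPx x z fun t ht => by have := hcover t ht; tauto
  have hwx : w ≠ x := by
    rintro rfl
    exact hzy (hN _ _ _ hzw.symm hxy)
  have hwy : w ≠ y := by
    rintro rfl
    exact hzx (hN _ _ _ hzw.symm hxy.symm)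
  have hXeq : X = {x, y, z, w} := by
    ext t
    rw [Finset.mem_insert, Finset.mem_insert, Finset.mem_insert, Finset.mem_singleton]
    refine ⟨hcover t, ?_⟩
    rintro (rfl | rfl | rfl | rfl)
    exacts [hxX, hleft hxy.symm, hzX, hleft hzw.symm]
  have hX4 : X.card = 4 := by
    have := hxy.ne
    have := hzw.ne
    rw [hXeq, Finset.card_insert_of_notMem (by grind), Finset.card_insert_of_notMem (by grind),
      Finset.card_pair hzw.ne]
  have := hpos P hP x hxX hPx
  exact ⟨by omega, x, y, z, w, hxy, hzw, hPx, fun t => by simp [hXeq], hzx, hzy, hwx, hwy,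
    hPu, hQu⟩

open Classical in
/-- A removable matching with at most `d / 2` edges can be enlarged by one edge: either an edge
between two unmatched vertices is added, or an edge of the matching is exchanged for two. -/
theorem exists_isMatchingGraph_succ [Fintype V] {G N : SimpleGraph V} {d k : ℕ}
    (hdeg : ∀ v, d ≤ (Finset.univ.filter (G.Adj v)).card) (hk : k ≤ 3) (hd : 3 ≤ d)
    (hkd : k + 1 ≤ d) (hkd' : 2 * k ≤ d + 1)
    (hG : ¬ (Even d ∧ Fintype.card V = d + 1))
    (hNG : N ≤ G) (hN : N.IsMatchingGraph) (hcon : (G \ N).IsVertexConnected k)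
    (hle : 2 * N.edgeSet.ncard ≤ d) :
    ∃ N' ≤ G, N'.IsMatchingGraph ∧ (G \ N').IsVertexConnected k ∧
      N'.edgeSet.ncard = N.edgeSet.ncard + 1 := by
  by_contra! hmax
  obtain ⟨H, hH⟩ : ∃ H, H = G \ N := ⟨_, rfl⟩
  rw [← hH] at hcon
  obtain ⟨U, hUdef⟩ : ∃ U : Finset V, U = Finset.univ.filter (· ∉ N.support) := ⟨_, rfl⟩
  have hmemU : ∀ {t}, t ∈ U ↔ t ∉ N.support := by simp [hUdef]
  have hUc : Uᶜ.card = 2 * N.edgeSet.ncard := by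
    rw [← hN.card_support]
    congr 1
    ext t
    rw [Finset.mem_compl, hmemU, not_not, Finset.mem_filter_univ]
  have hHU : ∀ t ∈ U, ∀ b, H.Adj t b ↔ G.Adj t b := by
    intro t ht b
    rw [hH, sdiff_adj]
    exact ⟨fun h => h.1, fun h => ⟨h, fun hb => hmemU.1 ht ⟨b, hb⟩⟩⟩
  have hdegU : ∀ t ∈ U, d ≤ (Finset.univ.filter (H.Adj t)).card := by
    intro t ht
    simpa only [hHU t ht] using hdeg t
  have hsat : H.IsSaturated U d := by
    refine ⟨fun W hWU hW => ?_, hdegU, fun t => ?_⟩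
    · refine hcon.exists_card_neighbors_le_one_of_critical hW (fun t ht => ?_) (fun t ht => ?_) ?_
      · have := hdegU t (hWU ht); omega
      · have := hdegU t (hWU ht); omega
      · intro x hx y hy hxy hcon'
        have hxS := hmemU.1 (hWU hx)
        have hyS := hmemU.1 (hWU hy)
        refine hmax (N ⊔ edge x y) (sup_le hNG ?_) (hN.sup_edge hxS hyS) ?_
          (ncard_edgeSet_sup_edge hxy.ne fun h => hxS ⟨y, h⟩)
        · exact (edge_le_iff G).2 (Or.inr ((hHU x (hWU hx) y).1 hxy))
        · rwa [← sdiff_sdiff_left, ← hH]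
    · by_cases ht : t ∈ U
      · exact (hdegU t ht).trans (Nat.le_succ _)
      · obtain ⟨w, hw⟩ := not_not.1 fun h => ht (hmemU.2 h)
        refine (hdeg t).trans ((Finset.card_le_card fun b hb => ?_).trans
          (Finset.card_insert_le w _))
        rw [Finset.mem_insert, Finset.mem_filter, hH, sdiff_adj]
        have hb := (Finset.mem_filter.1 hb).2
        by_cases hbw : N.Adj t b
        · exact Or.inl (hN _ _ _ hbw hw)
        · exact Or.inr ⟨Finset.mem_univ _, hb, hbw⟩
  have hcardV : Uᶜ.card + U.card = Fintype.card V := by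
    rw [add_comm]; exact Finset.card_add_card_compl U
  have hdV : d + 1 ≤ Fintype.card V := by
    have : Nonempty V := ⟨(Fintype.card_pos_iff.1 (by have := hcon.1; omega)).some⟩
    obtain ⟨t⟩ := this
    have h1 : Finset.univ.filter (G.Adj t) ⊆ Finset.univ.erase t := fun b hb =>
      Finset.mem_erase.2 ⟨(Finset.mem_filter.1 hb).2.ne', Finset.mem_univ _⟩
    have h2 := Finset.card_le_card h1
    have h3 := Finset.card_erase_add_one (Finset.mem_univ t)
    have h4 := hdeg t
    rw [Finset.card_univ] at h3
    omega
  -- a single unmatched vertex would leave `d` even and `G` complete of order `d + 1`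
  have hU2 : 2 ≤ U.card := by
    by_contra hlt
    exact hG ⟨⟨N.edgeSet.ncard, by omega⟩, by omega⟩
  -- a vertex with at most one neighbour in `U` misses at most one matched vertex
  have hmiss : ∀ u ∈ U, (U.filter (H.Adj u)).card ≤ 1 →
      (Uᶜ.filter (¬ H.Adj u ·)).card + d ≤ Uᶜ.card + 1 := by
    intro u hu hu1
    have h1 := Finset.card_filter_add_card_filter_not (s := Uᶜ) (H.Adj u)
    have h2 : Finset.univ.filter (H.Adj u) = U.filter (H.Adj u) ∪ Uᶜ.filter (H.Adj u) := by
      rw [← Finset.filter_union, Finset.union_compl]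
    have h3 := hdegU u hu
    rw [h2] at h3
    have h4 := Finset.card_union_le (U.filter (H.Adj u)) (Uᶜ.filter (H.Adj u))
    omega
  obtain ⟨u, huU, -⟩ := Finset.one_lt_card.1 hU2
  obtain ⟨u, hu, -, hu1⟩ := exists_ne_card_neighbors_le_one hsat.exists_le_one U subset_rfl hU2 u
  obtain ⟨v, hv, hvu, hv1⟩ := exists_ne_card_neighbors_le_one hsat.exists_le_one U subset_rfl hU2 u
  have hmu := hmiss u hu hu1
  have hmv := hmiss v hv hv1
  have hswap : ∀ {x y p q : V}, N.Adj x y → p ∈ U → q ∈ U → p ≠ q → H.Adj p x → H.Adj q y →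
      ¬ (G \ N.augment p x y q).IsVertexConnected k := by
    intro x y p q hxy hp hq hpq hpx hqy hcon'
    exact hmax _ (augment_le hNG ((hHU p hp x).1 hpx) ((hHU q hq y).1 hqy).symm)
      (hN.augment hxy (hmemU.1 hp) (hmemU.1 hq) hpq) hcon'
      (IsMatchingGraph.ncard_edgeSet_augment hxy (hmemU.1 hp) (hmemU.1 hq) hpq)
  have hadj : ∀ x y p q a b : V, H.Adj a b → (G \ N.augment p x y q).Adj a b ∨ a = p ∧ b = x ∨
      a = x ∧ b = p ∨ a = y ∧ b = q ∨ a = q ∧ b = y := by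
    intro x y p q a b hab
    simp only [hH, augment, sdiff_adj, sup_adj, edge_adj] at hab ⊢
    tauto
  have hadj' : ∀ {x y p q : V}, N.Adj x y → p ∈ U → q ∈ U → (G \ N.augment p x y q).Adj x y := by
    intro x y p q hxy hp hq
    have hxU : x ∉ U := fun h => hmemU.1 h ⟨y, hxy⟩
    have hyU : y ∉ U := fun h => hmemU.1 h ⟨x, hxy.symm⟩
    have := hxy.ne
    have := hNG hxy
    simp only [augment, sdiff_adj, sup_adj, edge_adj]
    grind
  -- by maximality, no matching edge lies in the common neighbourhood of `u` and `v`
  have hno : ∀ x y, N.Adj x y → ¬ (H.Adj u x ∧ H.Adj u y ∧ H.Adj v x ∧ H.Adj v y) := by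
    rintro x y hxy ⟨hux, huy, hvx, hvy⟩
    have hxU : x ∉ U := fun h => hmemU.1 h ⟨y, hxy⟩
    have hyU : y ∉ U := fun h => hmemU.1 h ⟨x, hxy.symm⟩
    refine hswap hxy hu hv hvu.symm hux hvy ?_
    -- `Uᶜ` has even cardinality, so a vertex is missed only if `d` is even
    have hpar : ∀ c : ℕ, c + d ≤ Uᶜ.card + 1 → c + k + 1 ≤ d ∧ c + 2 * k ≤ d + 1 := by
      intro c hc
      constructor <;> omega
    exact hsat.isVertexConnected_of_swap hcon hk hu hv hxU hyU hvu.symm hux huy hvx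
      (fun h => (hH ▸ h : (G \ N).Adj x y).2 hxy)
      (hpar _ hmu).1 (hpar _ hmu).2 (hpar _ hmv).1 (hpar _ hmv).2 (hadj x y u v) (hadj' hxy hu hv)
  obtain ⟨rfl, x, y, z, w, hxy, hzw, hux, hX, hzx, hzy, hwx, hwy, hPx, hQz⟩ :=
    hN.exists_of_cover (X := Uᶜ) (P := (¬ H.Adj u ·)) (Q := (¬ H.Adj v ·))
      (by intro t; rw [Finset.mem_compl, hmemU, not_not]) hd (by omega)
      (by convert hmu) (by convert hmv)
      (fun x y hxy => by simpa only [not_and_or] using hno x y hxy)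
  have hUc' : ∀ t, t ∉ U ↔ t = x ∨ t = y ∨ t = z ∨ t = w := fun t => by
    rw [← Finset.mem_compl, hX]
  have hadju : ∀ t, t ∉ U → t ≠ x → H.Adj u t := fun t ht htx =>
    not_not.1 fun h => htx (hPx t (Finset.mem_compl.2 ht) h)
  have hadjv : ∀ t, t ∉ U → t ≠ z → H.Adj v t := fun t ht htz =>
    not_not.1 fun h => htz (hQz t (Finset.mem_compl.2 ht) h)
  have hxU : x ∉ U := (hUc' x).2 (Or.inl rfl)
  have hyU : y ∉ U := (hUc' y).2 (Or.inr (Or.inl rfl))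
  have hzU : z ∉ U := (hUc' z).2 (Or.inr (Or.inr (Or.inl rfl)))
  have hwU : w ∉ U := (hUc' w).2 (Or.inr (Or.inr (Or.inr rfl)))
  refine hswap hxy hv hu hvu (hadjv x hxU hzx.symm) (hadju y hyU hxy.ne.symm) ?_
  exact hsat.isVertexConnected_of_swap_four hcon (by omega) hu hv hvu.symm hUc' hzy hwy hwx
    (hadjv x hxU hzx.symm) (hadjv y hyU hzy.symm) (hadjv w hwU hzw.ne.symm)
    (hadju z hzU hzx) (hadju w hwU hwx) hux (hadj x y v u) (hadj' hxy hv hu)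

open Classical in
/-- The case of minimum degree at least three, by enlarging the empty matching. -/
theorem hasRemovableMatching_of_three_le [Fintype V] {G : SimpleGraph V} {d k : ℕ}
    (hdeg : ∀ v, d ≤ (Finset.univ.filter (G.Adj v)).card) (hk : k ≤ 3) (hd : 3 ≤ d)
    (hkd : k + 1 ≤ d) (hkd' : 2 * k ≤ d + 1) (hG : ¬ (Even d ∧ Fintype.card V = d + 1))
    (hcon : G.IsVertexConnected k) :
    G.HasRemovableMatching k ⌈((d : ℚ) + 1) / 2⌉₊ := by
  suffices h : ∀ m, m ≤ ⌈((d : ℚ) + 1) / 2⌉₊ → ∃ N ≤ G, N.IsMatchingGraph ∧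
      (G \ N).IsVertexConnected k ∧ N.edgeSet.ncard = m by
    obtain ⟨N, hNG, hN, hcon, hm⟩ := h _ le_rfl
    rw [← hm]
    exact hasRemovableMatching_of_isMatchingGraph hN hNG hcon
  intro m
  induction m with
  | zero =>
    exact fun _ => ⟨⊥, bot_le, fun _ _ _ h => h.elim, by rwa [sdiff_bot], by simp⟩
  | succ m ih =>
    intro hm
    obtain ⟨N, hNG, hN, hcon, rfl⟩ := ih (by omega)
    refine exists_isMatchingGraph_succ hdeg hk hd hkd hkd' hG hNG hN hcon ?_
    have h1 : ((N.edgeSet.ncard : ℕ) : ℚ) < ((d : ℚ) + 1) / 2 := Nat.lt_ceil.1 hm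
    rw [lt_div_iff₀ two_pos] at h1
    have h2 : N.edgeSet.ncard * 2 < d + 1 := by exact_mod_cast h1
    omega

open Classical in
theorem iso_completeGraph_of_card [Fintype V] {G : SimpleGraph V} {d : ℕ}
    (hdeg : ∀ v, d ≤ (Finset.univ.filter (G.Adj v)).card) (hcard : Fintype.card V = d + 1) :
    Nonempty (G ≃g completeGraph (Fin (d + 1))) := by
  have htop : G = ⊤ := by
    ext a b
    rw [top_adj]
    refine ⟨Adj.ne, fun hab => ?_⟩
    have h1 : Finset.univ.filter (G.Adj a) ⊆ Finset.univ.erase a := fun b hb =>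
      Finset.mem_erase.2 ⟨(Finset.mem_filter.1 hb).2.ne', Finset.mem_univ _⟩
    have h2 := Finset.eq_of_subset_of_card_le h1 (by
      rw [Finset.card_erase_of_mem (Finset.mem_univ _), Finset.card_univ, hcard]
      exact hdeg a)
    have h3 : b ∈ Finset.univ.filter (G.Adj a) := by
      rw [h2]
      exact Finset.mem_erase.2 ⟨hab.symm, Finset.mem_univ _⟩
    exact (Finset.mem_filter.1 h3).2
  subst htop
  exact ⟨Iso.completeGraph (Fintype.equivFinOfCardEq hcard)⟩

end

end SimpleGraph

theorem theorem3 {V : Type*} [Fintype V] (G : SimpleGraph V) [DecidableRel G.Adj] :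
    (∀ k : ℕ, 1 ≤ k → k ≤ 2 →
      G.IsVertexConnected k → k + 1 ≤ G.minDegree →
      ¬ (G.minDegree = 2 ∧ G.IsCycleGraph) →
      ¬ (4 ≤ G.minDegree ∧ Even G.minDegree ∧
          Nonempty (G ≃g SimpleGraph.completeGraph (Fin (G.minDegree + 1)))) →
      G.HasRemovableMatching k ⌈((G.minDegree : ℚ) + 1) / 2⌉₊) ∧
    (G.IsVertexConnected 3 → 5 ≤ G.minDegree →
      ¬ (Even G.minDegree ∧
          Nonempty (G ≃g SimpleGraph.completeGraph (Fin (G.minDegree + 1)))) →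
      G.HasRemovableMatching 3 ⌈((G.minDegree : ℚ) + 1) / 2⌉₊) := by
  classical
  have hdeg : ∀ v, G.minDegree ≤ (Finset.univ.filter (G.Adj v)).card := fun v => by
    rw [← SimpleGraph.neighborFinset_eq_filter, SimpleGraph.card_neighborFinset_eq_degree]
    exact G.minDegree_le_degree v
  refine ⟨fun k hk1 hk2 hcon hd hcyc hcomp => ?_, fun hcon hd hcomp => ?_⟩
  · by_cases h2 : G.minDegree = 2
    · obtain rfl : k = 1 := by omega
      have hceil : ⌈((G.minDegree : ℚ) + 1) / 2⌉₊ = 2 := by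
        rw [h2, Nat.ceil_eq_iff two_ne_zero]
        norm_num
      rw [hceil]
      exact SimpleGraph.hasRemovableMatching_one_two
        (SimpleGraph.isVertexConnected_one_iff.1 hcon).2
        (fun v => h2 ▸ G.minDegree_le_degree v) fun h => hcyc ⟨h2, h⟩
    · refine SimpleGraph.hasRemovableMatching_of_three_le (by convert hdeg) (by omega) (by omega)
        hd (by omega) ?_ hcon
      rintro ⟨heven, hcard⟩
      refine hcomp ⟨?_, heven, SimpleGraph.iso_completeGraph_of_card (by convert hdeg) hcard⟩
      obtain ⟨c, hc⟩ := heven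
      omega
  · refine SimpleGraph.hasRemovableMatching_of_three_le (by convert hdeg) (by omega) (by omega)
      (by omega) (by omega) ?_ hcon
    rintro ⟨heven, hcard⟩
    exact hcomp ⟨heven, SimpleGraph.iso_completeGraph_of_card (by convert hdeg) hcard⟩
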